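/- Let $b_0,k_0>0$ and let $k_m,k_s\in L^\infty([0,2\pi])$ be real-valued. For $N\ge 1$ put $\rho_0=N/(2\pi)$ and $a_0^2=k_0/\rho_0^2$, and consider on $x\in[0,2\pi]$ the mistuned platoon PDE $$\frac{\partial^2 v}{\partial t^2}+b_0\frac{\partial v}{\partial t}=a_0^2\frac{\partial^2 v}{\partial x^2}+\epsilon\left[\frac{k_m(x)}{\rho_0}\frac{\partial v}{\partial x}+\frac{k_s(x)}{2\rho_0^2}\frac{\partial^2 v}{\partial x^2}\right]$$ with Neumann–Dirichlet boundary conditions $\frac{\partial v}{\partial x}(0,t)=v(2\pi,t)=0$. A number $s\in\mathbb C$ is an eigenvalue if there is a nonzero $\eta\in H^2(0,2\pi)$ with $\eta'(0)=\eta(2\pi)=0$ and $$s^2\eta+b_0s\,\eta=a_0^2\eta''+\epsilon\left[\frac{k_m}{\rho_0}\eta'+\frac{k_s}{2\rho_0^2}\eta''\right]\quad\text{a.e. on }(0,2\pi).$$ For $\epsilon=0$ the eigenvalues belonging to the eigenfunction $\cos\frac{(2l-1)x}{4}$, $l=1,2,\dots$, are $$s_l^{\pm}(0)=\frac{-b_0\pm\sqrt{b_0^2-a_0^2(2l-1)^2/4}}{2}.$$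 Theorem. For every integer $l\ge1$ there are $\epsilon_0>0$, $N_0$ and $C$ (depending only on $l,b_0,k_0,k_m,k_s$) such that for all $N\ge N_0$ one has $b_0^2-a_0^2(2l-1)^2/4>0$, and $s_l^{\pm}(0)$ extend to unique continuous branches $\epsilon\mapsto s_l^{\pm}(\epsilon)$, $0\le\epsilon\le\epsilon_0$, of eigenvalues (also unique as branches on any $[0,\epsilon_1]$ with $0<\epsilon_1\le\epsilon_0$). With $$A_{l,N}=\frac{2l-1}{4b_0N}\int_0^{2\pi}k_m(x)\sin\left(\frac{(2l-1)x}{2}\right)dx$$ they satisfy $$s_l^+(\epsilon)=-\epsilon A_{l,N}+O(\epsilon^2)+O\left(\tfrac1{N^2}\right),\qquad s_l^-(\epsilon)=-b_0+\epsilon A_{l,N}+O(\epsilon^2)+O\left(\tfrac1{N^2}\right).$$ More precisely, the $O(1/N^2)$ terms consist of the value at $\epsilon=0$ and of $\epsilon$ times a correction of the first-order coefficient: $$s_l^+(0)=O\left(\tfrac1{N^2}\right),\qquad s_l^-(0)=-b_0+O\left(\tfrac1{N^2}\right),\qquad s_l^{\pm}(\epsilon)=s_l^{\pm}(0)\mp\epsilon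 A_{l,N}+O(\epsilon^2)+\epsilon\, O\left(\tfrac1{N^2}\right).$$ All $O$-terms are bounded with the constant $C$, uniformly in $0\le\epsilon\le\epsilon_0$ and $N\ge N_0$. -/

import Mathlib

open MeasureTheory Set

noncomputable section

/-- The mean density `ρ₀ = N / (2π)` of a platoon of `N` vehicles on `[0, 2π]`. -/
def meanDensity (N : ℕ) : ℝ := N / (2 * Real.pi)

/-- The square `a₀² = k₀ / ρ₀²` of the nominal wave speed. -/
def waveSpeedSq (k0 : ℝ) (N : ℕ) : ℝ := k0 / meanDensity N ^ 2

/-- Lebesgue measure on `[0, 2π]`. -/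
def platoonMeasure : Measure ℝ := volume.restrict (Icc 0 (2 * Real.pi))

/-- `η` belongs to the Sobolev space `H²(0, 2π)` with first derivative `η'` and second derivative
`η''`: on the interval, `η` is a primitive of `η'`, and `η'` is a primitive of the
square-integrable function `η''`. -/
structure IsH2 (η η' η'' : ℝ → ℂ) : Prop where
  memLp : MemLp η'' 2 platoonMeasure
  deriv_eq : ∀ x ∈ Icc (0 : ℝ) (2 * Real.pi), η' x = η' 0 + ∫ t in (0 : ℝ)..x, η'' t
  eq : ∀ x ∈ Icc (0 : ℝ) (2 * Real.pi), η x = η 0 + ∫ t in (0 : ℝ)..x, η' t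

/-- `s` is an eigenvalue of the mistuned PDE
`v_tt + b₀ v_t = a₀² v_xx + ε (k_m / ρ₀ v_x + k_s / (2 ρ₀²) v_xx)` on `[0, 2π]`
with Neumann-Dirichlet boundary conditions `v_x(0, t) = v(2π, t) = 0`: there is a nonzero `η`
such that `v(x, t) = exp (s t) η(x)` is a solution. -/
def IsEigenvalueND (b0 k0 : ℝ) (km ks : ℝ → ℝ) (N : ℕ) (ε : ℝ) (s : ℂ) : Prop :=
  ∃ η η' η'' : ℝ → ℂ, IsH2 η η' η'' ∧ η' 0 = 0 ∧ η (2 * Real.pi) = 0 ∧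
    (∃ x ∈ Icc (0 : ℝ) (2 * Real.pi), η x ≠ 0) ∧
    ∀ᵐ x ∂platoonMeasure,
      s ^ 2 * η x + (b0 : ℂ) * s * η x =
        (waveSpeedSq k0 N : ℂ) * η'' x +
          (ε : ℂ) * (((km x / meanDensity N : ℝ) : ℂ) * η' x +
            ((ks x / (2 * meanDensity N ^ 2) : ℝ) : ℂ) * η'' x)

/-- The discriminant of the characteristic equation `s² + b₀ s - a₀² λ_l = 0` of the symmetric
platoon, where `λ_l = -(2l - 1)² / 16` is the `l`-th eigenvalue of the Neumann-Dirichlet Laplacian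
on `[0, 2π]`, with eigenfunction `cos ((2l - 1) x / 4)`, `l = 1, 2, …`. -/
def nominalDiscr (b0 k0 : ℝ) (N l : ℕ) : ℝ :=
  b0 ^ 2 - 4 * waveSpeedSq k0 N * ((2 * (l : ℝ) - 1) ^ 2 / 16)

/-- The `l`-th less stable eigenvalue `s_l⁺(0)` of the symmetric platoon (used where
the discriminant is positive). -/
def nominalPlus (b0 k0 : ℝ) (N l : ℕ) : ℝ := (-b0 + √(nominalDiscr b0 k0 N l)) / 2

/-- The companion eigenvalue `s_l⁻(0)` of the symmetric platoon (used where
the discriminant is positive). -/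
def nominalMinus (b0 k0 : ℝ) (N l : ℕ) : ℝ := (-b0 - √(nominalDiscr b0 k0 N l)) / 2

/-- `s` is, on `0 ≤ ε ≤ ε₁`, a continuous branch of eigenvalues of the mistuned PDE that starts
at `s₀` for `ε = 0`. -/
structure IsEigenvalueBranchND (b0 k0 : ℝ) (km ks : ℝ → ℝ) (N : ℕ) (ε₁ : ℝ) (s₀ : ℂ)
    (s : ℝ → ℂ) : Prop where
  continuousOn : ContinuousOn s (Icc 0 ε₁)
  start : s 0 = s₀
  isEigenvalue : ∀ ε ∈ Icc 0 ε₁, IsEigenvalueND b0 k0 km ks N ε (s ε)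

/-- The coefficient `(2l - 1) / (4 b₀ N) ∫₀^{2π} k_m(x) sin ((2l - 1) x / 2) dx`. -/
def mistuningCoeff (b0 : ℝ) (km : ℝ → ℝ) (N l : ℕ) : ℝ :=
  (2 * (l : ℝ) - 1) / (4 * b0 * N) *
    ∫ x in (0 : ℝ)..(2 * Real.pi), km x * Real.sin ((2 * (l : ℝ) - 1) * x / 2)

end

/-! Multiplied by `ρ²`, where `ρ = N/(2π)`, the eigenvalue equation reads `η'' + p η' + lam w η = 0`
with `q = k₀ + ε k_s/2`, `p = ε ρ k_m/q`, `w = 1/q` and `lam = -ρ² (s² + b₀ s)`. An integrating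
factor makes the problem self-adjoint, so `lam` is real (`IsMixedEigenfunction.im_eq_zero`). In
Prüfer coordinates `η = e^R cos φ`, `η' = -ω e^R sin φ` the angle solves a scalar first-order
equation, and `lam` is a spectral value exactly when `cos φ(2π) = 0`.

By the comparison formula `IsPruferAngle.exists_sub_eq`, `φ(2π)` is strictly increasing in `lam` and
continuous in `(ε, lam)`. Hence for each `ε` a single `lam = L(ε)` has `φ(2π) = 2πν`, `ν =
(2l-1)/4`, and `L` is continuous. Along any continuous branch of eigenvalues `φ(2π)` moves
continuously in a discrete set, so the branch stays on `L`; the two roots of `s² + b₀ s + L/ρ² = 0`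
cannot be interchanged because the discriminant stays positive (`MistuningBdd.branch_unique`).

For the asymptotics the size of the perturbation is `δ = ε ρ`, which is unbounded in `N` at fixed
`ε`. Still, `L = k₀ν² + c δ + O(δ² + ε)` holds for every `δ` (`MistuningBdd.exists_lam_expansion`):
for small `δ` by expanding the angle to first order and using monotonicity, for large `δ` because
the a priori bound of `MistuningBdd.le_angle` makes every term `O(δ²)`. Division by `ρ²` turns the
error into `O(ε² + ε/ρ²)`, and `abs_root_expansion` shows that the square root in `s` adds only
errors of the same order. -/

/-! ### Calculus of absolutely continuous functions and Grönwall's inequality. -/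

section Primitive

open Filter Topology AbsolutelyContinuousOnInterval

variable {E : Type*} [NormedAddCommGroup E] [NormedSpace ℝ E]

/-- `F` is absolutely continuous on `[0, T]` with integrable derivative `f`. -/
structure IsPrimitiveOn (T : ℝ) (F f : ℝ → E) : Prop where
  absCont : AbsolutelyContinuousOnInterval F 0 T
  integrable : IntervalIntegrable f volume 0 T
  hasDerivAt : ∀ᵐ x, x ∈ Ioo 0 T → HasDerivAt F (f x) x

theorem AbsolutelyContinuousOnInterval.of_dist_le {X Y : Type*} [PseudoMetricSpace X]
    [PseudoMetricSpace Y] {f : ℝ → X} {g : ℝ → Y} {a b K : ℝ}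
    (hg : AbsolutelyContinuousOnInterval g a b)
    (h : ∀ x ∈ uIcc a b, ∀ y ∈ uIcc a b, dist (f x) (f y) ≤ K * dist (g x) (g y)) :
    AbsolutelyContinuousOnInterval f a b := by
  rw [absolutelyContinuousOnInterval_iff] at hg ⊢
  intro ε hε
  obtain ⟨δ, hδ, H⟩ := hg (ε / (|K| + 1)) (by positivity)
  refine ⟨δ, hδ, fun E hE hs ↦ ?_⟩
  have h1 := H E hE hs
  calc ∑ i ∈ Finset.range E.1, dist (f (E.2 i).1) (f (E.2 i).2)
      ≤ ∑ i ∈ Finset.range E.1, (|K| + 1) * dist (g (E.2 i).1) (g (E.2 i).2) := by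
        refine Finset.sum_le_sum fun i hi ↦ (h _ (hE.1 i hi).1 _ (hE.1 i hi).2).trans ?_
        gcongr
        linarith [le_abs_self K]
    _ = (|K| + 1) * ∑ i ∈ Finset.range E.1, dist (g (E.2 i).1) (g (E.2 i).2) := by
        rw [Finset.mul_sum]
    _ < (|K| + 1) * (ε / (|K| + 1)) := by gcongr
    _ = ε := by field_simp

variable {T : ℝ}

/-- Increments of `F` are dominated by those of the primitive of `‖f‖`, which is absolutely
continuous; the derivative comes from Lebesgue differentiation. -/
theorem IsPrimitiveOn.of_integral [CompleteSpace E] {F f : ℝ → E} (hT : 0 ≤ T)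
    (hf : IntervalIntegrable f volume 0 T)
    (h : ∀ x ∈ Icc 0 T, F x = F 0 + ∫ t in (0 : ℝ)..x, f t) : IsPrimitiveOn T F f := by
  refine ⟨?_, hf, ?_⟩
  · have hn := hf.norm.absolutelyContinuousOnInterval_intervalIntegral (c := 0) (by simp)
    refine hn.of_dist_le (K := 1) fun x hx y hy ↦ ?_
    rw [uIcc_of_le hT] at hx hy
    have sub : ∀ z ∈ Icc 0 T, uIcc 0 z ⊆ uIcc 0 T := fun z hz ↦ by
      rw [uIcc_of_le hT, uIcc_of_le hz.1]; exact Icc_subset_Icc_right hz.2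
    have ix := hf.mono_set (sub x hx)
    have iy := hf.mono_set (sub y hy)
    rw [h x hx, h y hy, dist_add_left, dist_comm, dist_comm (∫ v in (0 : ℝ)..x, ‖f v‖),
      dist_eq_norm, dist_eq_norm,
      intervalIntegral.integral_interval_sub_left iy ix,
      intervalIntegral.integral_interval_sub_left iy.norm ix.norm, one_mul]
    exact intervalIntegral.norm_integral_le_abs_integral_norm
  · filter_upwards [hf.ae_hasDerivAt_integral] with x hx hx'
    have h1 := (hx (by rw [uIcc_of_le hT]; exact Ioo_subset_Icc_self hx') 0 (by simp)).const_add
      (F 0)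
    refine h1.congr_of_eventuallyEq ?_
    filter_upwards [Ioo_mem_nhds hx'.1 hx'.2] with y hy
    exact h y (Ioo_subset_Icc_self hy)

/-- `F` minus the integral of `f` is absolutely continuous with derivative zero almost everywhere,
hence constant. -/
theorem IsPrimitiveOn.eq_add_integral [CompleteSpace E] {F f : ℝ → E} (h : IsPrimitiveOn T F f) :
    ∀ x ∈ Icc 0 T, F x = F 0 + ∫ t in (0 : ℝ)..x, f t := by
  intro x hx
  have hT : 0 ≤ T := hx.1.trans hx.2
  have h0 : IsPrimitiveOn T (fun x ↦ ∫ t in (0 : ℝ)..x, f t) f :=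
    .of_integral hT h.integrable (by simp)
  obtain ⟨C, hC⟩ := (h.absCont.sub h0.absCont).const_of_ae_hasDerivAt_zero (by
    have e0 : ∀ᵐ x : ℝ, x ≠ 0 := by simp [ae_iff, measure_singleton]
    have eT : ∀ᵐ x : ℝ, x ≠ T := by simp [ae_iff, measure_singleton]
    filter_upwards [h.hasDerivAt, h0.hasDerivAt, e0, eT] with x h1 h2 h3 h4 h5
    rw [uIcc_of_le hT] at h5
    have h6 : x ∈ Ioo 0 T := ⟨lt_of_le_of_ne h5.1 h3.symm, lt_of_le_of_ne h5.2 h4⟩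
    simpa using (h1 h6).sub (h2 h6))
  have e1 := hC x (by rwa [uIcc_of_le hT])
  have e2 := hC 0 (by simp)
  simp only [Pi.sub_apply, intervalIntegral.integral_same, sub_zero] at e1 e2
  rw [e2, ← e1]; abel

theorem IsPrimitiveOn.continuousOn {F f : ℝ → E} (hT : 0 ≤ T) (h : IsPrimitiveOn T F f) :
    ContinuousOn F (Icc 0 T) := by
  simpa [uIcc_of_le hT] using h.absCont.continuousOn

theorem IsPrimitiveOn.congr {F f g : ℝ → E} (hT : 0 ≤ T) (h : IsPrimitiveOn T F f)
    (hfg : ∀ᵐ x, x ∈ Ioc 0 T → f x = g x) : IsPrimitiveOn T F g := by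
  refine ⟨h.absCont, h.integrable.congr_ae ?_, ?_⟩
  · rw [uIoc_of_le hT]
    exact (ae_restrict_iff' measurableSet_Ioc).2 hfg
  · filter_upwards [h.hasDerivAt, hfg] with x h1 h2 h3
    exact h2 (Ioo_subset_Ioc_self h3) ▸ h1 h3

theorem IsPrimitiveOn.mul {A : Type*} [NormedField A] [NormedAlgebra ℝ A] {F f G g : ℝ → A}
    (hT : 0 ≤ T) (hF : IsPrimitiveOn T F f) (hG : IsPrimitiveOn T G g)
    {u : ℝ → A} (hu : ∀ᵐ x, x ∈ Ioc 0 T → f x * G x + F x * g x = u x) :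
    IsPrimitiveOn T (fun x ↦ F x * G x) u := by
  refine IsPrimitiveOn.congr (f := fun x ↦ f x * G x + F x * g x) hT ⟨?_, ?_, ?_⟩ hu
  · exact AbsolutelyContinuousOnInterval.smul (f := F) (g := G) hF.absCont hG.absCont
  · exact (hF.integrable.mul_continuousOn hG.absCont.continuousOn).add
      (hG.integrable.continuousOn_mul hF.absCont.continuousOn)
  · filter_upwards [hF.hasDerivAt, hG.hasDerivAt] with x h1 h2 h3
    exact (h1 h3).mul (h2 h3)

theorem IsPrimitiveOn.sub {F f G g : ℝ → E}
    (hF : IsPrimitiveOn T F f) (hG : IsPrimitiveOn T G g) :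
    IsPrimitiveOn T (fun x ↦ F x - G x) (fun x ↦ f x - g x) := by
  refine ⟨hF.absCont.sub hG.absCont, hF.integrable.sub hG.integrable, ?_⟩
  filter_upwards [hF.hasDerivAt, hG.hasDerivAt] with x h1 h2 h3
  exact (h1 h3).sub (h2 h3)

theorem IsPrimitiveOn.clm {E' : Type*} [NormedAddCommGroup E'] [NormedSpace ℝ E'] {F f : ℝ → E}
    (hF : IsPrimitiveOn T F f) (L : E →L[ℝ] E') :
    IsPrimitiveOn T (fun x ↦ L (F x)) (fun x ↦ L (f x)) := by
  refine ⟨hF.absCont.of_dist_le (K := ‖L‖) fun x _ y _ ↦ ?_, ?_, ?_⟩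
  · simpa using L.lipschitz.dist_le_mul (F x) (F y)
  · exact ⟨L.integrable_comp hF.integrable.1, L.integrable_comp hF.integrable.2⟩
  · filter_upwards [hF.hasDerivAt] with x h1 h3
    exact L.hasFDerivAt.comp_hasDerivAt x (h1 h3)

/-- `F` is bounded on the interval and a `C¹` function is Lipschitz on compact intervals, so
composition preserves absolute continuity. -/
theorem IsPrimitiveOn.comp_contDiff {F f : ℝ → ℝ} (hF : IsPrimitiveOn T F f) {h h' : ℝ → ℝ}
    (hh : ∀ x, HasDerivAt h (h' x) x) (hc : Continuous h') :
    IsPrimitiveOn T (fun x ↦ h (F x)) (fun x ↦ h' (F x) * f x) := by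
  have hd : deriv h = h' := funext fun x ↦ (hh x).deriv
  have hC : ContDiff ℝ 1 h :=
    contDiff_one_iff_deriv.2 ⟨fun x ↦ (hh x).differentiableAt, hd ▸ hc⟩
  obtain ⟨C, hC'⟩ := hF.absCont.exists_bound
  obtain ⟨K, hK⟩ := (hC.contDiffOn (s := Icc (-C) C)).exists_lipschitzOnWith (by decide)
    (convex_Icc _ _) isCompact_Icc
  refine ⟨hF.absCont.of_dist_le (K := K) fun x hx y hy ↦ ?_, ?_, ?_⟩
  · exact hK.dist_le_mul _ (abs_le.1 (hC' x hx)) _ (abs_le.1 (hC' y hy))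
  · exact hF.integrable.continuousOn_mul (hc.comp_continuousOn hF.absCont.continuousOn)
  · filter_upwards [hF.hasDerivAt] with x h1 h3
    exact (hh _).comp x (h1 h3)

/-- A bounded measurable function on the line is interval integrable. -/
theorem intervalIntegrable_of_bdd {f : ℝ → ℝ} {B : ℝ} (hf : Measurable f) (hB : ∀ x, |f x| ≤ B)
    (a b : ℝ) : IntervalIntegrable f volume a b :=
  (intervalIntegrable_const (c := B)).mono_fun hf.aestronglyMeasurable
    (Eventually.of_forall fun x ↦ by
      simpa using (hB x).trans (le_abs_self B))

/-- Grönwall's inequality in integral form, for a vanishing initial value. -/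
theorem eq_zero_of_le_integral {u : ℝ → ℝ} {K : ℝ} (hT : 0 ≤ T) (hK : 0 ≤ K)
    (hc : ContinuousOn u (Icc 0 T)) (h0 : ∀ x ∈ Icc 0 T, 0 ≤ u x)
    (h : ∀ x ∈ Icc 0 T, u x ≤ K * ∫ t in (0 : ℝ)..x, u t) : ∀ x ∈ Icc 0 T, u x = 0 := by
  have iu : IntervalIntegrable u volume 0 T :=
    ContinuousOn.intervalIntegrable (by rwa [uIcc_of_le hT])
  have hU : IsPrimitiveOn T (fun x ↦ ∫ t in (0 : ℝ)..x, u t) u := .of_integral hT iu (by simp)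
  have hid : IsPrimitiveOn T (fun x ↦ x) (fun _ ↦ 1) :=
    .of_integral hT intervalIntegrable_const (by simp)
  have hE := hid.comp_contDiff (h := fun x ↦ Real.exp (-K * x))
    (h' := fun x ↦ Real.exp (-K * x) * (-K))
    (fun x ↦ by simpa using ((hasDerivAt_id x).const_mul (-K)).exp) (by fun_prop)
  -- With `U = ∫ u`, the derivative of `e^{-Kx} U` is `e^{-Kx} (u - K U) ≤ 0`, so `U ≤ 0`.
  have hP := hE.mul hT hU (Eventually.of_forall fun x _ ↦ rfl)
  intro x hx
  have e := hP.eq_add_integral x hx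
  have hle : ∫ t in (0 : ℝ)..x, (Real.exp (-K * t) * (-K) * 1 * (∫ s in (0 : ℝ)..t, u s) +
      Real.exp (-K * t) * u t) ≤ 0 := by
    rw [intervalIntegral.integral_of_le hx.1]
    refine setIntegral_nonpos measurableSet_Ioc fun t ht ↦ ?_
    have := h t ⟨ht.1.le, ht.2.trans hx.2⟩
    have := mul_nonneg (Real.exp_pos (-K * t)).le (sub_nonneg.2 this)
    linarith
  simp only [intervalIntegral.integral_same, mul_zero, zero_add] at e
  have h2 : ∫ t in (0 : ℝ)..x, u t ≤ 0 := by
    by_contra hcon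
    push Not at hcon
    have := mul_pos (Real.exp_pos (-K * x)) hcon
    linarith
  have := h x hx
  exact le_antisymm (this.trans (mul_nonpos_of_nonneg_of_nonpos hK h2)) (h0 x hx)

end Primitive

/-! ### The Prüfer equation: existence, comparison and continuous dependence. -/

section Prufer

open Filter Topology

/-- The right-hand side `α sin² φ + β cos² φ + γ sin φ cos φ` of the Prüfer equation. -/
noncomputable def pruferField (α β γ : ℝ → ℝ) (t φ : ℝ) : ℝ :=
  α t * Real.sin φ ^ 2 + β t * Real.cos φ ^ 2 + γ t * (Real.sin φ * Real.cos φ)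

/-- The coefficients of the Prüfer equation are measurable and bounded by `B`. -/
structure PruferBdd (B : ℝ) (α β γ : ℝ → ℝ) : Prop where
  measα : Measurable α
  measβ : Measurable β
  measγ : Measurable γ
  leα : ∀ x, |α x| ≤ B
  leβ : ∀ x, |β x| ≤ B
  leγ : ∀ x, |γ x| ≤ B

/-- `φ` solves the Prüfer equation on `[0, T]` with `φ 0 = 0`. -/
structure IsPruferAngle (T : ℝ) (α β γ : ℝ → ℝ) (φ : ℝ → ℝ) : Prop where
  cont : Continuous φ
  eq : ∀ x ∈ Icc 0 T, φ x = ∫ t in (0 : ℝ)..x, pruferField α β γ t (φ t)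

variable {T B : ℝ} {α β γ α' β' γ' φ φ' : ℝ → ℝ}

theorem abs_sin_sq_sub_le (a b : ℝ) : |Real.sin a ^ 2 - Real.sin b ^ 2| ≤ |a - b| := by
  have e : Real.sin a ^ 2 - Real.sin b ^ 2 = (Real.cos (2 * b) - Real.cos (2 * a)) / 2 := by
    rw [Real.cos_two_mul, Real.cos_two_mul, Real.cos_sq', Real.cos_sq']; ring
  have := Real.abs_cos_sub_cos_le (2 * b) (2 * a)
  rw [e, abs_div, abs_two]
  rw [← mul_sub, abs_mul, abs_two, abs_sub_comm b a] at this
  linarith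

theorem abs_cos_sq_sub_le (a b : ℝ) : |Real.cos a ^ 2 - Real.cos b ^ 2| ≤ |a - b| := by
  rw [Real.cos_sq', Real.cos_sq',
    show (1 - Real.sin a ^ 2 - (1 - Real.sin b ^ 2)) = -(Real.sin a ^ 2 - Real.sin b ^ 2) by ring,
    abs_neg]
  exact abs_sin_sq_sub_le a b

theorem abs_sin_mul_cos_sub_le (a b : ℝ) :
    |Real.sin a * Real.cos a - Real.sin b * Real.cos b| ≤ |a - b| := by
  have e : Real.sin a * Real.cos a - Real.sin b * Real.cos b =
      (Real.sin (2 * a) - Real.sin (2 * b)) / 2 := by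
    rw [Real.sin_two_mul, Real.sin_two_mul]; ring
  have := Real.abs_sin_sub_sin_le (2 * a) (2 * b)
  rw [e, abs_div, abs_two]
  rw [← mul_sub, abs_mul, abs_two] at this
  linarith

theorem sin_sq_mem (a : ℝ) : 0 ≤ Real.sin a ^ 2 ∧ Real.sin a ^ 2 ≤ 1 :=
  ⟨sq_nonneg _, Real.sin_sq_le_one a⟩

theorem cos_sq_mem (a : ℝ) : 0 ≤ Real.cos a ^ 2 ∧ Real.cos a ^ 2 ≤ 1 :=
  ⟨sq_nonneg _, Real.cos_sq_le_one a⟩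

theorem abs_sin_mul_cos_le (a : ℝ) : |Real.sin a * Real.cos a| ≤ 1 / 2 := by
  rw [abs_le]
  constructor <;> nlinarith [Real.sin_sq_add_cos_sq a, sq_nonneg (Real.sin a + Real.cos a),
    sq_nonneg (Real.sin a - Real.cos a)]

theorem abs_three_le {a b c x y z X Y Z : ℝ} (ha : |a| ≤ X) (hb : |b| ≤ Y) (hc : |c| ≤ Z)
    {D : ℝ} (hx : |x| ≤ D) (hy : |y| ≤ D) (hz : |z| ≤ D) :
    |a * x + b * y + c * z| ≤ (X + Y + Z) * D := by
  have hX := (abs_nonneg a).trans ha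
  have hY := (abs_nonneg b).trans hb
  have hZ := (abs_nonneg c).trans hc
  calc |a * x + b * y + c * z| ≤ |a * x| + |b * y| + |c * z| := abs_add_three _ _ _
    _ ≤ X * D + Y * D + Z * D := by
        simp only [abs_mul]
        gcongr
    _ = _ := by ring

theorem PruferBdd.nonneg (h : PruferBdd B α β γ) : 0 ≤ B := (abs_nonneg _).trans (h.leα 0)

theorem PruferBdd.field_lipschitz (h : PruferBdd B α β γ) (t a b : ℝ) :
    |pruferField α β γ t a - pruferField α β γ t b| ≤ 3 * B * |a - b| := by
  have := abs_three_le (h.leα t) (h.leβ t) (h.leγ t) (abs_sin_sq_sub_le a b)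
    (abs_cos_sq_sub_le a b) (abs_sin_mul_cos_sub_le a b)
  rw [show B + B + B = 3 * B by ring] at this
  refine le_of_eq_of_le ?_ this
  congr 1
  unfold pruferField; ring

theorem PruferBdd.field_bound (h : PruferBdd B α β γ) (t a : ℝ) :
    |pruferField α β γ t a| ≤ 3 * B := by
  have := abs_three_le (D := 1) (h.leα t) (h.leβ t) (h.leγ t)
    (by rw [abs_of_nonneg (sin_sq_mem a).1]; exact (sin_sq_mem a).2)
    (by rw [abs_of_nonneg (cos_sq_mem a).1]; exact (cos_sq_mem a).2)
    ((abs_sin_mul_cos_le a).trans (by norm_num))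
  rw [show (B + B + B) * 1 = 3 * B by ring] at this
  exact this

theorem PruferBdd.field_measurable (h : PruferBdd B α β γ) (hφ : Measurable φ) :
    Measurable fun t ↦ pruferField α β γ t (φ t) := by
  have := h.measα; have := h.measβ; have := h.measγ
  unfold pruferField
  fun_prop

theorem PruferBdd.field_intervalIntegrable (h : PruferBdd B α β γ) (hφ : Measurable φ)
    (a b : ℝ) : IntervalIntegrable (fun t ↦ pruferField α β γ t (φ t)) volume a b :=
  intervalIntegrable_of_bdd (h.field_measurable hφ) (fun t ↦ h.field_bound t _) a b

theorem integral_exp_mul_le {K x : ℝ} (hK : 0 < K) :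
    K * ∫ t in (0 : ℝ)..x, Real.exp (2 * K * t) ≤ Real.exp (2 * K * x) / 2 := by
  have : ∫ t in (0 : ℝ)..x, Real.exp (2 * K * t) = (2 * K)⁻¹ * (Real.exp (2 * K * x) - 1) := by
    rw [intervalIntegral.integral_comp_mul_left (fun t ↦ Real.exp t) (by positivity)]
    simp
  rw [this]
  have : K * ((2 * K)⁻¹ * (Real.exp (2 * K * x) - 1)) = (Real.exp (2 * K * x) - 1) / 2 := by
    field_simp
  rw [this]; linarith

/-- The Prüfer equation with bounded measurable coefficients has a solution: the Picard operator
is a contraction of `C([0, T])` in an exponentially weighted norm. -/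
theorem PruferBdd.exists_angle (h : PruferBdd B α β γ) (hT : 0 ≤ T) :
    ∃ φ, IsPruferAngle T α β γ φ := by
  -- `3 * B` is the Lipschitz constant of the field; the summand `1` keeps `K` positive when `B =
  -- 0`.
  set K : ℝ := 3 * B + 1 with hKdef
  have hB := h.nonneg
  have hK : 0 < K := by positivity
  -- Here `u` stands for `e^{-2Kt} φ`, so the sup norm of `u` is the weighted norm of `φ`.
  let lift : C(Icc 0 T, ℝ) → ℝ → ℝ := fun u t ↦ Real.exp (2 * K * t) * u (projIcc 0 T hT t)
  have lift_cont : ∀ u, Continuous (lift u) := fun u ↦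
    (by fun_prop : Continuous fun t : ℝ ↦ Real.exp (2 * K * t)).mul
      (u.continuous.comp continuous_projIcc)
  have int_u : ∀ u a b, IntervalIntegrable (fun t ↦ pruferField α β γ t (lift u t)) volume a b :=
    fun u ↦ h.field_intervalIntegrable (lift_cont u).measurable
  have prim_cont : ∀ u, Continuous fun x : ℝ ↦
      ∫ t in (0 : ℝ)..x, pruferField α β γ t (lift u t) := fun u ↦
    intervalIntegral.continuous_primitive (int_u u) 0
  let P : C(Icc 0 T, ℝ) → C(Icc 0 T, ℝ) := fun u ↦
    ⟨fun x ↦ Real.exp (-(2 * K * x)) * ∫ t in (0 : ℝ)..x, pruferField α β γ t (lift u t),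
      (by fun_prop : Continuous fun x : Icc 0 T ↦ Real.exp (-(2 * K * x))).mul
        ((prim_cont u).comp continuous_subtype_val)⟩
  have hP : ContractingWith (1 / 2) P := by
    refine ⟨by norm_num, LipschitzWith.of_dist_le_mul fun u v ↦ ?_⟩
    rw [ContinuousMap.dist_le (by positivity)]
    rintro ⟨x, hx⟩
    have key : ∀ t ∈ Ioc 0 x,
        ‖pruferField α β γ t (lift u t) - pruferField α β γ t (lift v t)‖ ≤
        K * dist u v * Real.exp (2 * K * t) := by
      intro t _
      have h1 := h.field_lipschitz t (lift u t) (lift v t)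
      have h2 : |lift u t - lift v t| ≤ Real.exp (2 * K * t) * dist u v := by
        simp only [lift]
        rw [← mul_sub, abs_mul, abs_of_pos (Real.exp_pos _)]
        gcongr
        exact ContinuousMap.dist_apply_le_dist (f := u) (g := v) _
      calc _ ≤ 3 * B * |lift u t - lift v t| := h1
        _ ≤ K * (Real.exp (2 * K * t) * dist u v) := by gcongr; linarith
        _ = _ := by ring
    have h3 : |∫ t in (0 : ℝ)..x, (pruferField α β γ t (lift u t) -
        pruferField α β γ t (lift v t))| ≤ Real.exp (2 * K * x) / 2 * dist u v := by
      have := intervalIntegral.norm_integral_le_of_norm_le (μ := volume) hx.1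
        (Eventually.of_forall key)
        ((by fun_prop : Continuous fun t : ℝ ↦
          K * dist u v * Real.exp (2 * K * t)).intervalIntegrable 0 x)
      rw [intervalIntegral.integral_const_mul] at this
      have h4 := mul_le_mul_of_nonneg_right (integral_exp_mul_le (x := x) hK)
        (dist_nonneg (x := u) (y := v))
      rw [Real.norm_eq_abs] at this
      linarith
    simp only [P, ContinuousMap.coe_mk, Real.dist_eq]
    rw [← mul_sub, ← intervalIntegral.integral_sub (int_u u 0 x) (int_u v 0 x), abs_mul,
      abs_of_pos (Real.exp_pos _)]
    calc _ ≤ Real.exp (-(2 * K * x)) * (Real.exp (2 * K * x) / 2 * dist u v) := by gcongr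
      _ = Real.exp (-(2 * K * x)) * Real.exp (2 * K * x) * (1 / 2 * dist u v) := by ring
      _ = _ := by rw [← Real.exp_add]; simp
  obtain ⟨u, hu, -⟩ := hP.exists_fixedPoint 0 (edist_ne_top _ _)
  refine ⟨lift u, lift_cont u, fun x hx ↦ ?_⟩
  have hx' := congrArg (fun f : C(Icc 0 T, ℝ) ↦ f ⟨x, hx⟩) hu
  simp only [P, ContinuousMap.coe_mk] at hx'
  calc lift u x = Real.exp (2 * K * x) * u ⟨x, hx⟩ := by simp only [lift, projIcc_of_mem hT hx]
    _ = Real.exp (2 * K * x) * Real.exp (-(2 * K * x)) *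
        ∫ t in (0 : ℝ)..x, pruferField α β γ t (lift u t) := by rw [← hx']; ring
    _ = _ := by rw [← Real.exp_add]; simp

theorem IsPruferAngle.zero (h : IsPruferAngle T α β γ φ) (hT : 0 ≤ T) : φ 0 = 0 := by
  simpa using h.eq 0 ⟨le_rfl, hT⟩

theorem IsPruferAngle.isPrimitiveOn (h : IsPruferAngle T α β γ φ) (hT : 0 ≤ T)
    (hB : PruferBdd B α β γ) : IsPrimitiveOn T φ fun t ↦ pruferField α β γ t (φ t) :=
  .of_integral hT (hB.field_intervalIntegrable h.cont.measurable _ _) fun x hx ↦ by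
    rw [h.zero hT, zero_add]; exact h.eq x hx

/-- The difference of two Prüfer angles is a weighted integral of the difference of the fields. -/
theorem IsPruferAngle.exists_sub_eq (hφ : IsPruferAngle T α β γ φ)
    (hφ' : IsPruferAngle T α' β' γ' φ') {B' : ℝ} (hT : 0 ≤ T) (hB : PruferBdd B α β γ)
    (hB' : PruferBdd B' α' β' γ') :
    ∃ w : ℝ → ℝ, Continuous w ∧ (∀ x ∈ Icc 0 T, 0 < w x ∧ w x ≤ Real.exp (6 * B' * T)) ∧
      φ' T - φ T = ∫ t in (0 : ℝ)..T,
        w t * (pruferField α' β' γ' t (φ t) - pruferField α β γ t (φ t)) := by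
  have hB0 := hB'.nonneg
  -- The difference quotient linearizes the equation: `(φ' - φ)' = k (φ' - φ)` plus the difference
  -- of the two fields along `φ`. The junk value `0` where the angles agree is harmless. With `κ = ∫
  -- k`, the integrating factor `e^{-κ}` yields the weight `w(t) = e^{κ(T) - κ(t)}`.
  let k : ℝ → ℝ := fun t ↦ (pruferField α' β' γ' t (φ' t) - pruferField α' β' γ' t (φ t)) /
    (φ' t - φ t)
  have m1 := hB'.field_measurable hφ.cont.measurable
  have m2 := hB'.field_measurable hφ'.cont.measurable
  have m3 := hB.field_measurable hφ.cont.measurable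
  have mφ := hφ.cont.measurable
  have mφ' := hφ'.cont.measurable
  have km : Measurable k := (m2.sub m1).div (mφ'.sub mφ)
  have kB : ∀ t, |k t| ≤ 3 * B' := fun t ↦ by
    simp only [k, abs_div]
    exact div_le_of_le_mul₀ (abs_nonneg _) (by positivity) (hB'.field_lipschitz t _ _)
  have kmul : ∀ t, k t * (φ' t - φ t) =
      pruferField α' β' γ' t (φ' t) - pruferField α' β' γ' t (φ t) := fun t ↦ by
    rcases eq_or_ne (φ' t) (φ t) with e | e
    · simp [e]
    · exact div_mul_cancel₀ _ (sub_ne_zero.2 e)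
  have kint := intervalIntegrable_of_bdd km kB
  set κ : ℝ → ℝ := fun x ↦ ∫ t in (0 : ℝ)..x, k t with hκ
  have κp : IsPrimitiveOn T κ k := .of_integral hT (kint 0 T) (by simp [hκ])
  have κc : Continuous κ := intervalIntegral.continuous_primitive kint 0
  have κB : ∀ x ∈ Icc 0 T, |κ x| ≤ 3 * B' * T := fun x hx ↦ by
    have := intervalIntegral.norm_integral_le_of_norm_le_const (f := k) (a := 0) (b := x)
      (C := 3 * B') (fun t _ ↦ kB t)
    rw [sub_zero, abs_of_nonneg hx.1] at this
    exact this.trans (by gcongr; exact hx.2)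
  have ep := κp.comp_contDiff (h := fun x ↦ Real.exp (-x)) (h' := fun x ↦ -Real.exp (-x))
    (fun x ↦ by simpa using (hasDerivAt_neg x).exp) (by fun_prop)
  have hp := ep.mul hT ((hφ'.isPrimitiveOn hT hB').sub (hφ.isPrimitiveOn hT hB))
    (u := fun t ↦ Real.exp (-κ t) *
      (pruferField α' β' γ' t (φ t) - pruferField α β γ t (φ t)))
    (Eventually.of_forall fun t _ ↦ by linear_combination (-Real.exp (-κ t)) * kmul t)
  have e := hp.eq_add_integral T ⟨hT, le_rfl⟩
  rw [hφ.zero hT, hφ'.zero hT, sub_zero, mul_zero, zero_add] at e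
  refine ⟨fun t ↦ Real.exp (κ T) * Real.exp (-κ t), by fun_prop, fun x hx ↦ ⟨by positivity, ?_⟩, ?_⟩
  · beta_reduce
    rw [← Real.exp_add]
    gcongr
    have h1 := (abs_le.1 (κB T ⟨hT, le_rfl⟩)).2
    have h2 := (abs_le.1 (κB x hx)).1
    linarith
  · simp_rw [mul_assoc]
    rw [intervalIntegral.integral_const_mul, ← e, ← mul_assoc, ← Real.exp_add]
    simp

/-- Needed because `pruferAngle` is an arbitrary choice: it lets an explicitly known angle be
evaluated in its place. -/
theorem IsPruferAngle.eqAt (hφ : IsPruferAngle T α β γ φ) (hφ' : IsPruferAngle T α β γ φ')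
    (hT : 0 ≤ T) (hB : PruferBdd B α β γ) : φ' T = φ T := by
  obtain ⟨w, -, -, e⟩ := hφ.exists_sub_eq hφ' hT hB hB
  simpa [sub_eq_zero] using e

/-- Increasing the coefficient of `cos²` increases the Prüfer angle. -/
theorem IsPruferAngle.lt_of_lt (hφ : IsPruferAngle T α β γ φ)
    (hφ' : IsPruferAngle T α β' γ φ') {B' : ℝ} (hT : 0 < T) (hB : PruferBdd B α β γ)
    (hB' : PruferBdd B' α β' γ) (hlt : ∀ x, β x < β' x) : φ T < φ' T := by
  obtain ⟨w, wc, wp, e⟩ := hφ.exists_sub_eq hφ' hT.le hB hB'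
  rw [← sub_pos, e]
  have e2 : ∀ t, w t * (pruferField α β' γ t (φ t) - pruferField α β γ t (φ t)) =
      w t * ((β' t - β t) * Real.cos (φ t) ^ 2) := fun t ↦ by unfold pruferField; ring
  simp_rw [e2]
  have hint : IntervalIntegrable (fun t ↦ w t * ((β' t - β t) * Real.cos (φ t) ^ 2)) volume 0 T := by
    refine (((hB'.field_intervalIntegrable hφ.cont.measurable 0 T).sub
      (hB.field_intervalIntegrable hφ.cont.measurable 0 T)).continuousOn_mul wc.continuousOn).congr
        fun t _ ↦ e2 t
  rw [intervalIntegral.integral_pos_iff_support_of_nonneg_ae' _ hint]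
  · refine ⟨hT, ?_⟩
    -- The integrand is nonnegative but vanishes where `cos φ` does; since `φ 0 = 0`, it is strictly
    -- positive just to the right of `0`.
    have hev : ∀ᶠ x in 𝓝 (0 : ℝ), 0 < Real.cos (φ x) := by
      have hc : Continuous fun x ↦ Real.cos (φ x) := Real.continuous_cos.comp hφ.cont
      exact hc.continuousAt.eventually_const_lt (by simp [hφ.zero hT.le])
    obtain ⟨δ, hδ, H⟩ := Metric.eventually_nhds_iff.1 hev
    refine lt_of_lt_of_le ?_ (measure_mono (s := Ioo 0 (min δ T)) ?_)
    · simp [hδ, hT]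
    · intro x hx
      have hx1 := hx.2.trans_le (min_le_left _ _)
      have hx2 := hx.2.trans_le (min_le_right _ _)
      have := H (y := x) (by rw [Real.dist_eq, sub_zero, abs_of_pos hx.1]; exact hx1)
      have h3 := (wp x ⟨hx.1.le, hx2.le⟩).1
      have h4 := sub_pos.2 (hlt x)
      exact ⟨(by positivity : 0 < w x * ((β' x - β x) * Real.cos (φ x) ^ 2)).ne', hx.1, hx2.le⟩
  · rw [Filter.EventuallyLE, ae_restrict_iff' measurableSet_uIoc]
    refine Eventually.of_forall fun x hx ↦ ?_
    rw [uIoc_of_le hT.le] at hx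
    have h3 := (wp x ⟨hx.1.le, hx.2⟩).1
    have h4 := sub_pos.2 (hlt x)
    simp only [Pi.zero_apply]
    positivity

/-- The Prüfer angle at `T` depends continuously on the coefficients. -/
theorem IsPruferAngle.tendsto {ι : Type*} {l : Filter ι} [l.IsCountablyGenerated]
    {a b c f : ι → ℝ → ℝ} (hφ : IsPruferAngle T α β γ φ) (hT : 0 ≤ T) (hB : PruferBdd B α β γ)
    (hf : ∀ᶠ i in l, IsPruferAngle T (a i) (b i) (c i) (f i))
    (hb : ∀ᶠ i in l, PruferBdd B (a i) (b i) (c i))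
    (ta : ∀ x, Tendsto (fun i ↦ a i x) l (𝓝 (α x)))
    (tb : ∀ x, Tendsto (fun i ↦ b i x) l (𝓝 (β x)))
    (tc : ∀ x, Tendsto (fun i ↦ c i x) l (𝓝 (γ x))) :
    Tendsto (fun i ↦ f i T) l (𝓝 (φ T)) := by
  have hB0 := hB.nonneg
  let g : ι → ℝ → ℝ := fun i t ↦ |α t - a i t| + |β t - b i t| + |γ t - c i t|
  have hg : Tendsto (fun i ↦ Real.exp (6 * B * T) * ∫ t in (0 : ℝ)..T, g i t) l (𝓝 0) := by
    have : Tendsto (fun i ↦ ∫ t in (0 : ℝ)..T, g i t) l (𝓝 (∫ t in (0 : ℝ)..T, 0)) := by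
      refine intervalIntegral.tendsto_integral_filter_of_dominated_convergence (fun _ ↦ 6 * B)
        ?_ ?_ intervalIntegrable_const ?_
      · filter_upwards [hb] with i hi
        exact ((((hB.measα.sub hi.measα).abs).add ((hB.measβ.sub hi.measβ).abs)).add
          ((hB.measγ.sub hi.measγ).abs)).aestronglyMeasurable
      · filter_upwards [hb] with i hi
        refine Eventually.of_forall fun t _ ↦ ?_
        simp only [g]
        rw [Real.norm_eq_abs, abs_of_nonneg (by positivity)]
        linarith [abs_sub (α t) (a i t), abs_sub (β t) (b i t), abs_sub (γ t) (c i t),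
          hB.leα t, hB.leβ t, hB.leγ t, hi.leα t, hi.leβ t, hi.leγ t]
      · refine Eventually.of_forall fun t _ ↦ ?_
        have h1 := ((ta t).const_sub (α t)).abs
        have h2 := ((tb t).const_sub (β t)).abs
        have h3 := ((tc t).const_sub (γ t)).abs
        simpa using (h1.add h2).add h3
    simpa using this.const_mul (Real.exp (6 * B * T))
  rw [tendsto_iff_dist_tendsto_zero]
  refine squeeze_zero' (Eventually.of_forall fun _ ↦ dist_nonneg) ?_ hg
  filter_upwards [hf, hb] with i hi hbi
  -- Both fields are evaluated along the same angle `f i`, so their difference is at most `g i`,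
  -- whatever that angle is, and no convergence of `f i` is presupposed.
  obtain ⟨w, wc, wp, e⟩ := hi.exists_sub_eq hφ hT hbi hB
  rw [dist_comm, Real.dist_eq, e, ← intervalIntegral.integral_const_mul]
  have gi : IntervalIntegrable (g i) volume 0 T := by
    refine intervalIntegrable_of_bdd (B := 6 * B)
      ((((hB.measα.sub hbi.measα).abs).add ((hB.measβ.sub hbi.measβ).abs)).add
          ((hB.measγ.sub hbi.measγ).abs)) (fun t ↦ ?_) _ _
    simp only [Pi.add_apply, Pi.sub_apply]
    rw [abs_of_nonneg (by positivity)]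
    linarith [abs_sub (α t) (a i t), abs_sub (β t) (b i t), abs_sub (γ t) (c i t),
          hB.leα t, hB.leβ t, hB.leγ t, hbi.leα t, hbi.leβ t, hbi.leγ t]
  rw [← Real.norm_eq_abs]
  refine intervalIntegral.norm_integral_le_of_norm_le hT
    (Eventually.of_forall fun t ht ↦ ?_)
    (gi.const_mul _)
  have hw := wp t ⟨ht.1.le, ht.2⟩
  rw [norm_mul, Real.norm_of_nonneg hw.1.le, Real.norm_eq_abs]
  refine mul_le_mul hw.2 ?_ (abs_nonneg _) (Real.exp_pos _).le
  have := abs_three_le (D := 1) (le_refl |α t - a i t|) (le_refl |β t - b i t|)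
    (le_refl |γ t - c i t|)
    (by rw [abs_of_nonneg (sin_sq_mem (f i t)).1]; exact (sin_sq_mem _).2)
    (by rw [abs_of_nonneg (cos_sq_mem (f i t)).1]; exact (cos_sq_mem _).2)
    ((abs_sin_mul_cos_le (f i t)).trans (by norm_num))
  rw [mul_one] at this
  refine le_of_eq_of_le ?_ this
  congr 1
  unfold pruferField; ring

/-- The solution of the Prüfer equation on `[0, T]`. -/
noncomputable def pruferAngle (T : ℝ) (α β γ : ℝ → ℝ) : ℝ → ℝ :=
  Classical.epsilon (IsPruferAngle T α β γ)

theorem PruferBdd.isPruferAngle (h : PruferBdd B α β γ) (hT : 0 ≤ T) :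
    IsPruferAngle T α β γ (pruferAngle T α β γ) :=
  Classical.epsilon_spec (h.exists_angle hT)

end Prufer

/-! ### The mixed Sturm-Liouville problem in Prüfer coordinates. -/

section SturmLiouville

open Filter Topology

/-- The coefficients of `η'' + p η' + μ w η = 0` are measurable and bounded by `B`, and the weight
`w` is bounded below by `c > 0`. -/
structure SturmBdd (c B : ℝ) (p w : ℝ → ℝ) : Prop where
  pos : 0 < c
  measp : Measurable p
  measw : Measurable w
  lep : ∀ x, |p x| ≤ B
  lew : ∀ x, |w x| ≤ B
  gew : ∀ x, c ≤ w x

/-- `η` is a nonzero solution of `η'' + p η' + μ w η = 0`, `η' 0 = 0`, `η T = 0`. -/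
structure IsMixedEigenfunction (T : ℝ) (p w : ℝ → ℝ) (μ : ℂ) (η η' η'' : ℝ → ℂ) : Prop where
  prim : IsPrimitiveOn T η η'
  prim' : IsPrimitiveOn T η' η''
  neumann : η' 0 = 0
  dirichlet : η T = 0
  ne_zero : ∃ x ∈ Icc 0 T, η x ≠ 0
  ode : ∀ᵐ x, x ∈ Ioc 0 T → η'' x = -(p x : ℂ) * η' x - μ * (w x : ℂ) * η x

variable {T c B ω lam : ℝ} {p w φ : ℝ → ℝ} {μ : ℂ} {η η' η'' : ℝ → ℂ}

theorem IsPrimitiveOn.ofReal {F f : ℝ → ℝ} (h : IsPrimitiveOn T F f) :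
    IsPrimitiveOn T (fun x ↦ (F x : ℂ)) (fun x ↦ (f x : ℂ)) := h.clm Complex.ofRealCLM

theorem IsPrimitiveOn.conj {F f : ℝ → ℂ} (h : IsPrimitiveOn T F f) :
    IsPrimitiveOn T (fun x ↦ (starRingEnd ℂ) (F x)) (fun x ↦ (starRingEnd ℂ) (f x)) :=
  h.clm (Complex.conjCLE : ℂ →L[ℝ] ℂ)

/-- Eigenvalues of the mixed problem are real. -/
theorem IsMixedEigenfunction.im_eq_zero (h : IsMixedEigenfunction T p w μ η η' η'') (hT : 0 < T)
    (hb : SturmBdd c B p w) : μ.im = 0 := by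
  set P : ℝ → ℝ := fun x ↦ ∫ t in (0 : ℝ)..x, p t with hP
  have ip := intervalIntegrable_of_bdd hb.measp hb.lep
  have Pp : IsPrimitiveOn T P p := .of_integral hT.le (ip _ _) (by simp [hP])
  have Pc : Continuous P := intervalIntegral.continuous_primitive ip 0
  have Ep := (Pp.comp_contDiff (h := Real.exp) (h' := Real.exp) Real.hasDerivAt_exp
    Real.continuous_exp).ofReal
  have hc := h.prim.continuousOn hT.le
  have hc' := h.prim'.continuousOn hT.le
  -- The factor `e^P` puts the equation in divergence form. Multiplying by the conjugate of `η` and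
  -- integrating, the boundary terms vanish and `∫ e^P |η'|² = μ ∫ w e^P |η|²`, with a positive
  -- integral on the right.
  have F1 := Ep.mul hT.le h.prim' (u := fun x ↦ -μ * (w x * Real.exp (P x) : ℝ) * η x) (by
    filter_upwards [h.ode] with x hx hx'
    rw [hx hx']; push_cast; ring)
  have F2 := F1.mul hT.le h.prim.conj (u := fun x ↦ ((Real.exp (P x) * ‖η' x‖ ^ 2 : ℝ) : ℂ) -
      μ * ((w x * Real.exp (P x) * ‖η x‖ ^ 2 : ℝ) : ℂ)) (by
    refine Eventually.of_forall fun x _ ↦ ?_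
    have e1 := Complex.mul_conj' (η x)
    have e2 := Complex.mul_conj' (η' x)
    push_cast
    rw [← e1, ← e2]; ring)
  have e := F2.eq_add_integral T ⟨hT.le, le_rfl⟩
  have iE : IntervalIntegrable (fun x ↦ Real.exp (P x) * ‖η' x‖ ^ 2) volume 0 T :=
    ContinuousOn.intervalIntegrable (by
      rw [uIcc_of_le hT.le]
      exact (Real.continuous_exp.comp Pc).continuousOn.mul (hc'.norm.pow 2))
  have cw : ContinuousOn (fun x ↦ Real.exp (P x) * ‖η x‖ ^ 2) (Icc 0 T) :=
    (Real.continuous_exp.comp Pc).continuousOn.mul (hc.norm.pow 2)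
  have iw : IntervalIntegrable (fun x ↦ w x * Real.exp (P x) * ‖η x‖ ^ 2) volume 0 T := by
    simp_rw [mul_assoc]
    exact (intervalIntegrable_of_bdd hb.measw hb.lew 0 T).mul_continuousOn
      (by rwa [uIcc_of_le hT.le])
  have iE' : IntervalIntegrable (fun x ↦ ((Real.exp (P x) * ‖η' x‖ ^ 2 : ℝ) : ℂ)) volume 0 T :=
    ⟨iE.1.ofReal, iE.2.ofReal⟩
  have iw' : IntervalIntegrable (fun x ↦ ((w x * Real.exp (P x) * ‖η x‖ ^ 2 : ℝ) : ℂ)) volume 0 T :=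
    ⟨iw.1.ofReal, iw.2.ofReal⟩
  rw [h.dirichlet, h.neumann, intervalIntegral.integral_sub iE' (iw'.const_mul μ),
    intervalIntegral.integral_const_mul, intervalIntegral.integral_ofReal,
    intervalIntegral.integral_ofReal] at e
  have e3 := congrArg Complex.im e
  simp only [map_zero, mul_zero, zero_mul, zero_add, Complex.sub_im, Complex.ofReal_im,
    Complex.mul_im, Complex.ofReal_re, Complex.zero_im, zero_sub] at e3
  have pos : 0 < ∫ x in (0 : ℝ)..T, w x * Real.exp (P x) * ‖η x‖ ^ 2 := by
    have h1 : 0 < ∫ x in (0 : ℝ)..T, c * (Real.exp (P x) * ‖η x‖ ^ 2) := by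
      obtain ⟨x, hx, hx'⟩ := h.ne_zero
      refine intervalIntegral.integral_pos hT (cw.const_smul c)
        (fun y _ ↦ by have := hb.pos; positivity) ⟨x, hx, ?_⟩
      have := hb.pos
      positivity
    refine h1.trans_le (intervalIntegral.integral_mono_on hT.le ?_ iw fun x _ ↦ ?_)
    · exact (ContinuousOn.intervalIntegrable (by rwa [uIcc_of_le hT.le])).const_mul c
    · rw [mul_assoc]
      exact mul_le_mul_of_nonneg_right (hb.gew x) (by positivity)
  have : μ.im * ∫ x in (0 : ℝ)..T, w x * Real.exp (P x) * ‖η x‖ ^ 2 = 0 := by linarith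
  exact (mul_eq_zero.1 this).resolve_right pos.ne'

/-- The initial value problem with zero data has only the zero solution. -/
theorem SturmBdd.eq_zero_of_init (hb : SturmBdd c B p w) (hT : 0 ≤ T)
    (h : IsPrimitiveOn T η η') (h' : IsPrimitiveOn T η' η'') (h0 : η 0 = 0) (h0' : η' 0 = 0)
    (ode : ∀ᵐ x, x ∈ Ioc 0 T → η'' x = -(p x : ℂ) * η' x - μ * (w x : ℂ) * η x) :
    ∀ x ∈ Icc 0 T, η x = 0 := by
  have hB : 0 ≤ B := (abs_nonneg _).trans (hb.lep 0)
  have hc := h.continuousOn hT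
  have hc' := h'.continuousOn hT
  have hu : ContinuousOn (fun x ↦ ‖η x‖ + ‖η' x‖) (Icc 0 T) := hc.norm.add hc'.norm
  have hsub : ∀ x ∈ Icc 0 T, IntervalIntegrable (fun x ↦ ‖η x‖ + ‖η' x‖) volume 0 x :=
    fun x hx ↦ ContinuousOn.intervalIntegrable (by
      rw [uIcc_of_le hx.1]; exact hu.mono (Icc_subset_Icc_right hx.2))
  have key := eq_zero_of_le_integral (K := 1 + B + ‖μ‖ * B) hT (by positivity) hu
    (fun x _ ↦ by positivity) (fun x hx ↦ ?_)
  · intro x hx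
    have := key x hx
    have h1 := norm_nonneg (η' x)
    exact norm_le_zero_iff.1 (by linarith)
  · have e1 := h.eq_add_integral x hx
    have e2 := h'.eq_add_integral x hx
    rw [h0, zero_add] at e1
    rw [h0', zero_add] at e2
    have b1 : ‖η x‖ ≤ ∫ t in (0 : ℝ)..x, 1 * (‖η t‖ + ‖η' t‖) := by
      rw [e1]
      refine intervalIntegral.norm_integral_le_of_norm_le hx.1
        (Eventually.of_forall fun t _ ↦ ?_) ((hsub x hx).const_mul 1)
      linarith [norm_nonneg (η t)]
    have b2 : ‖η' x‖ ≤ ∫ t in (0 : ℝ)..x, (B + ‖μ‖ * B) * (‖η t‖ + ‖η' t‖) := by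
      rw [e2]
      refine intervalIntegral.norm_integral_le_of_norm_le hx.1 ?_ ((hsub x hx).const_mul _)
      filter_upwards [ode] with t ht ht'
      rw [ht ⟨ht'.1, ht'.2.trans hx.2⟩]
      have n1 : ‖-(p t : ℂ) * η' t‖ ≤ B * ‖η' t‖ := by
        rw [norm_mul, norm_neg, Complex.norm_real]
        gcongr
        exact hb.lep t
      have n2 : ‖μ * (w t : ℂ) * η t‖ ≤ ‖μ‖ * B * ‖η t‖ := by
        rw [norm_mul, norm_mul, Complex.norm_real]
        gcongr
        exact hb.lew t
      have n3 := norm_sub_le (-(p t : ℂ) * η' t) (μ * (w t : ℂ) * η t)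
      have n4 : 0 ≤ B * ‖η t‖ := by positivity
      have n5 : 0 ≤ ‖μ‖ * B * ‖η' t‖ := by positivity
      linarith
    rw [intervalIntegral.integral_const_mul] at b1 b2
    linarith

/-- The Prüfer equation, with scale `ω`, of `η'' + p η' + λ w η = 0`. -/
def IsSturmAngle (T ω lam : ℝ) (p w φ : ℝ → ℝ) : Prop :=
  IsPruferAngle T (fun _ ↦ ω) (fun x ↦ lam * w x / ω) (fun x ↦ -p x) φ

theorem SturmBdd.pruferBdd (hb : SturmBdd c B p w) (hω : 0 < ω) {B' : ℝ} (h1 : ω ≤ B')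
    (h2 : |lam| * B / ω ≤ B') (h3 : B ≤ B') :
    PruferBdd B' (fun _ ↦ ω) (fun x ↦ lam * w x / ω) (fun x ↦ -p x) := by
  refine ⟨measurable_const, (hb.measw.const_mul lam).div_const ω, hb.measp.neg,
    fun _ ↦ by rwa [abs_of_pos hω], fun x ↦ ?_, fun x ↦ by rw [abs_neg]; exact (hb.lep x).trans h3⟩
  rw [abs_div, abs_mul, abs_of_pos hω]
  refine le_trans ?_ h2
  gcongr
  exact hb.lew x

theorem SturmBdd.pruferBdd' (hb : SturmBdd c B p w) (hω : 0 < ω) (lam : ℝ) :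
    PruferBdd (ω + |lam| * B / ω + B) (fun _ ↦ ω) (fun x ↦ lam * w x / ω) (fun x ↦ -p x) := by
  have hB : 0 ≤ B := (abs_nonneg _).trans (hb.lep 0)
  have : 0 ≤ |lam| * B / ω := by positivity
  refine hb.pruferBdd hω ?_ ?_ ?_ <;> linarith

/-- The solution with `y 0 = 1`, `y' 0 = 0`, in Prüfer coordinates. -/
theorem IsSturmAngle.exists_solution (h : IsSturmAngle T ω lam p w φ) (hT : 0 ≤ T) (hω : 0 < ω)
    (hb : SturmBdd c B p w) : ∃ y y' : ℝ → ℝ, Continuous y ∧ Continuous y' ∧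
      IsPrimitiveOn T y y' ∧ IsPrimitiveOn T y' (fun x ↦ -p x * y' x - lam * w x * y x) ∧
      y 0 = 1 ∧ y' 0 = 0 ∧ (y T = 0 ↔ Real.cos (φ T) = 0) := by
  have hB := hb.pruferBdd' hω lam
  have hφ := h.isPrimitiveOn hT hB
  -- Logarithmic growth rate of the amplitude, chosen so that `e^R cos φ` has derivative `-ω e^R sin
  -- φ`. It has the shape of a Prüfer field, so the same bounds apply.
  let ρ : ℝ → ℝ := fun x ↦ pruferField (fun x ↦ -p x) (fun _ ↦ 0)
    (fun x ↦ lam * w x / ω - ω) x (φ x)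
  have hBρ : PruferBdd (ω + |lam| * B / ω + B + ω) (fun x ↦ -p x) (fun _ ↦ 0)
      (fun x ↦ lam * w x / ω - ω) :=
    ⟨hB.measγ, measurable_const, hB.measβ.sub_const ω, fun x ↦ by linarith [hB.leγ x],
      fun x ↦ by simp only [abs_zero]; linarith [hB.nonneg],
      fun x ↦ (abs_sub _ _).trans (by rw [abs_of_pos hω]; linarith [hB.leβ x])⟩
  have hρi := hBρ.field_intervalIntegrable h.cont.measurable
  set R : ℝ → ℝ := fun x ↦ ∫ t in (0 : ℝ)..x, ρ t with hR
  have Rc : Continuous R := intervalIntegral.continuous_primitive hρi 0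
  have Rp : IsPrimitiveOn T R ρ := .of_integral hT (hρi 0 T) (by simp [hR])
  have rp := Rp.comp_contDiff (h := Real.exp) (h' := Real.exp) Real.hasDerivAt_exp
    Real.continuous_exp
  have sp := hφ.comp_contDiff (h := Real.sin) (h' := Real.cos) Real.hasDerivAt_sin
    Real.continuous_cos
  have cp := hφ.comp_contDiff (h := Real.cos) (h' := fun x ↦ -Real.sin x) Real.hasDerivAt_cos
    (by fun_prop)
  have φc := h.cont
  refine ⟨fun x ↦ Real.exp (R x) * Real.cos (φ x),
    fun x ↦ -ω * Real.exp (R x) * Real.sin (φ x), by fun_prop, by fun_prop, ?_, ?_, ?_, ?_, ?_⟩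
  · refine rp.mul hT cp (Eventually.of_forall fun x _ ↦ ?_)
    simp only [ρ, pruferField]
    linear_combination (-ω * Real.exp (R x) * Real.sin (φ x)) * Real.sin_sq_add_cos_sq (φ x)
  · have hω' : IsPrimitiveOn T (fun _ ↦ -ω) (fun _ ↦ (0 : ℝ)) :=
      .of_integral hT intervalIntegrable_const (by simp)
    refine (hω'.mul hT rp (Eventually.of_forall fun x _ ↦ rfl)).mul hT sp
      (Eventually.of_forall fun x _ ↦ ?_)
    simp only [ρ, pruferField]
    have hω0 := hω.ne'
    field_simp
    have := Real.sin_sq_add_cos_sq (φ x)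
    have hs : Real.sin (φ x) ^ 2 = 1 - Real.cos (φ x) ^ 2 := by linarith
    ring_nf
    rw [show Real.sin (φ x) ^ 3 = Real.sin (φ x) * Real.sin (φ x) ^ 2 by ring, hs]
    ring
  · simp [hR, h.zero hT]
  · simp [h.zero hT]
  · simp [(Real.exp_pos _).ne']

/-- With `y` the solution normalized by `y 0 = 1`, `y' 0 = 0`, the difference `η - η(0) y` has zero
initial data and so vanishes. Then `η(0) ≠ 0`, and the Dirichlet condition passes to `y`. -/
theorem IsMixedEigenfunction.cos_eq_zero (h : IsMixedEigenfunction T p w (lam : ℂ) η η' η'')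
    (hT : 0 ≤ T) (hb : SturmBdd c B p w) (hω : 0 < ω) (hφ : IsSturmAngle T ω lam p w φ) :
    Real.cos (φ T) = 0 := by
  obtain ⟨y, y', -, -, py, py', y0, y0', hy⟩ := hφ.exists_solution hT hω hb
  have hk : IsPrimitiveOn T (fun _ ↦ η 0) (fun _ ↦ (0 : ℂ)) :=
    .of_integral hT intervalIntegrable_const (by simp)
  have d1 := h.prim.sub (hk.mul hT py.ofReal (u := fun x ↦ η 0 * y' x)
    (Eventually.of_forall fun x _ ↦ by ring))
  have d2 := h.prim'.sub (hk.mul hT py'.ofReal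
    (u := fun x ↦ η 0 * (-p x * y' x - lam * w x * y x))
    (Eventually.of_forall fun x _ ↦ by push_cast; ring))
  have z := hb.eq_zero_of_init (μ := lam) hT d1 d2 (by simp [y0]) (by simp [y0', h.neumann]) (by
    filter_upwards [h.ode] with x hx hx'
    rw [hx hx']; ring)
  have hT' := z T ⟨hT, le_rfl⟩
  rw [h.dirichlet, zero_sub, neg_eq_zero, mul_eq_zero] at hT'
  rcases hT' with h0 | h0
  · obtain ⟨x, hx, hx'⟩ := h.ne_zero
    have := z x hx
    rw [h0, zero_mul, sub_zero] at this
    exact absurd this hx'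
  · exact hy.1 (by exact_mod_cast h0)

/-- A continuous real eigenfunction exists when the Prüfer angle at `T` is an odd multiple of
`π / 2`. -/
theorem IsSturmAngle.exists_isMixedEigenfunction (hφ : IsSturmAngle T ω lam p w φ)
    (hT : 0 ≤ T) (hb : SturmBdd c B p w) (hω : 0 < ω) (h : Real.cos (φ T) = 0) :
    ∃ y y' : ℝ → ℝ, Continuous y ∧ Continuous y' ∧
      IsMixedEigenfunction T p w (lam : ℂ) (fun x ↦ (y x : ℂ)) (fun x ↦ (y' x : ℂ))
        (fun x ↦ ((-p x * y' x - lam * w x * y x : ℝ) : ℂ)) := by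
  obtain ⟨y, y', cy, cy', py, py', y0, y0', hy⟩ := hφ.exists_solution hT hω hb
  refine ⟨y, y', cy, cy', py.ofReal, py'.ofReal, by simp [y0'], by simp [hy.2 h],
    ⟨0, ⟨le_rfl, hT⟩, by simp [y0]⟩, Eventually.of_forall fun x _ ↦ by push_cast; ring⟩

end SturmLiouville

/-! ### The Prüfer angle of the mistuned platoon and its spectral parameter. -/

section Platoon

open Filter Topology

/-- Everywhere bounded measurable mistuning profiles. -/
structure MistuningBdd (k0 M : ℝ) (km ks : ℝ → ℝ) : Prop where
  k0_pos : 0 < k0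
  M_pos : 0 < M
  measm : Measurable km
  meass : Measurable ks
  lem : ∀ x, |km x| ≤ M
  les : ∀ x, |ks x| ≤ M

/-- The leading coefficient `k₀ + ε k_s / 2` after multiplication of the equation by `ρ₀²`. -/
noncomputable def leadCoeff (k0 ε : ℝ) (ks : ℝ → ℝ) (x : ℝ) : ℝ := k0 + ε * ks x / 2

/-- The Prüfer scale `ν + (M / k₀) ε ρ`. -/
noncomputable def pruferScale (k0 M ν ρ ε : ℝ) : ℝ := ν + M / k0 * (ε * ρ)

/-- The Prüfer angle at `2π` of the mistuned problem, as a function of `ε` and the spectral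
parameter `lam`. -/
noncomputable def platoonAngle (k0 M ν ρ : ℝ) (km ks : ℝ → ℝ) (ε lam : ℝ) : ℝ → ℝ :=
  pruferAngle (2 * Real.pi) (fun _ ↦ pruferScale k0 M ν ρ ε)
    (fun x ↦ lam * (1 / leadCoeff k0 ε ks x) / pruferScale k0 M ν ρ ε)
    (fun x ↦ -(ε * ρ * km x / leadCoeff k0 ε ks x))

variable {k0 M ν ρ ε lam : ℝ} {km ks : ℝ → ℝ}

/-- The admissible values of `ε`. -/
def SmallMistuning (k0 M ε : ℝ) : Prop := 0 ≤ ε ∧ ε ≤ 1 ∧ ε * M ≤ k0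

theorem leadCoeff_bounds {s : ℝ} (hε : SmallMistuning k0 M ε) (hs : |s| ≤ M) :
    k0 / 2 ≤ k0 + ε * s / 2 ∧ k0 + ε * s / 2 ≤ 3 * k0 / 2 := by
  obtain ⟨h1, h2⟩ := abs_le.1 hs
  have h3 := mul_le_mul_of_nonneg_left h1 hε.1
  have h4 := mul_le_mul_of_nonneg_left h2 hε.1
  have := hε.2.2
  constructor <;> linarith

theorem pruferScale_ge (h : MistuningBdd k0 M km ks) (hε : 0 ≤ ε) (hρ : 0 ≤ ρ) :
    ν ≤ pruferScale k0 M ν ρ ε := by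
  have := h.k0_pos; have := h.M_pos
  unfold pruferScale
  have : 0 ≤ M / k0 * (ε * ρ) := by positivity
  linarith

theorem MistuningBdd.sturmBdd (h : MistuningBdd k0 M km ks) (hε : SmallMistuning k0 M ε)
    (hρ : 0 ≤ ρ) : SturmBdd (2 / (3 * k0)) (2 / k0 + 2 * M / k0 * ρ)
      (fun x ↦ ε * ρ * km x / leadCoeff k0 ε ks x) (fun x ↦ 1 / leadCoeff k0 ε ks x) := by
  have hk := h.k0_pos
  have hM := h.M_pos
  have mq : Measurable (leadCoeff k0 ε ks) := by
    have := h.meass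
    unfold leadCoeff
    fun_prop
  have q1 : ∀ x, k0 / 2 ≤ leadCoeff k0 ε ks x := fun x ↦ (leadCoeff_bounds hε (h.les x)).1
  have q2 : ∀ x, leadCoeff k0 ε ks x ≤ 3 * k0 / 2 := fun x ↦ (leadCoeff_bounds hε (h.les x)).2
  have q0 : ∀ x, 0 < leadCoeff k0 ε ks x := fun x ↦ (by positivity : 0 < k0 / 2).trans_le (q1 x)
  refine ⟨by positivity, (h.measm.const_mul _).div mq, measurable_const.div mq, fun x ↦ ?_,
    fun x ↦ ?_, fun x ↦ ?_⟩
  · rw [abs_div, abs_mul, abs_of_nonneg (mul_nonneg hε.1 hρ), abs_of_pos (q0 x)]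
    calc ε * ρ * |km x| / leadCoeff k0 ε ks x ≤ 1 * ρ * M / (k0 / 2) := by
          have := hε.2.1
          gcongr
          · exact h.lem x
          · exact q1 x
      _ = 2 * M / k0 * ρ := by field_simp
      _ ≤ _ := by have : 0 < 2 / k0 := by positivity
                  linarith
  · rw [abs_of_pos (one_div_pos.2 (q0 x))]
    calc 1 / leadCoeff k0 ε ks x ≤ 1 / (k0 / 2) := by gcongr; exact q1 x
      _ = 2 / k0 := by field_simp
      _ ≤ _ := by have : 0 ≤ 2 * M / k0 * ρ := by positivity
                  linarith
  · calc 2 / (3 * k0) = 1 / (3 * k0 / 2) := by field_simp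
      _ ≤ _ := by
        have := q0 x
        gcongr
        exact q2 x

theorem MistuningBdd.isSturmAngle (h : MistuningBdd k0 M km ks) (hε : SmallMistuning k0 M ε)
    (hρ : 0 ≤ ρ) (hν : 0 < ν) (lam : ℝ) :
    IsSturmAngle (2 * Real.pi) (pruferScale k0 M ν ρ ε) lam
      (fun x ↦ ε * ρ * km x / leadCoeff k0 ε ks x) (fun x ↦ 1 / leadCoeff k0 ε ks x)
      (platoonAngle k0 M ν ρ km ks ε lam) :=
  ((h.sturmBdd hε hρ).pruferBdd' (hν.trans_le (pruferScale_ge h hε.1 hρ)) lam).isPruferAngle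
    (by positivity)

theorem MistuningBdd.angle_strictMono (h : MistuningBdd k0 M km ks) (hε : SmallMistuning k0 M ε)
    (hρ : 0 ≤ ρ) (hν : 0 < ν) :
    StrictMono fun lam ↦ platoonAngle k0 M ν ρ km ks ε lam (2 * Real.pi) := by
  intro a b hab
  have hω := hν.trans_le (pruferScale_ge (ν := ν) h hε.1 hρ)
  have hs := h.sturmBdd hε hρ
  refine (h.isSturmAngle hε hρ hν a).lt_of_lt (h.isSturmAngle hε hρ hν b) (by positivity)
    (hs.pruferBdd' hω a) (hs.pruferBdd' hω b) fun x ↦ ?_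
  have := hs.pos.trans_le (hs.gew x)
  gcongr

theorem MistuningBdd.angle_tendsto {ι : Type*} {l : Filter ι} [l.IsCountablyGenerated]
    (h : MistuningBdd k0 M km ks) (hε : SmallMistuning k0 M ε)
    (hρ : 0 ≤ ρ) (hν : 0 < ν) {e L : ι → ℝ} (he : ∀ᶠ i in l, SmallMistuning k0 M (e i))
    (te : Tendsto e l (𝓝 ε)) (tL : Tendsto L l (𝓝 lam)) :
    Tendsto (fun i ↦ platoonAngle k0 M ν ρ km ks (e i) (L i) (2 * Real.pi)) l
      (𝓝 (platoonAngle k0 M ν ρ km ks ε lam (2 * Real.pi))) := by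
  have hk := h.k0_pos
  have hM := h.M_pos
  set B₀ := 2 / k0 + 2 * M / k0 * ρ with hB₀
  have hB₀' : 0 < B₀ := by positivity
  set B := (ν + M / k0 * ρ) + (|lam| + 1) * B₀ / ν + B₀ with hB
  -- Continuous dependence requires one bound on the coefficients for all parameters near `(ε,
  -- lam)`.
  have bdd : ∀ e' L' : ℝ, SmallMistuning k0 M e' → |L'| ≤ |lam| + 1 →
      PruferBdd B (fun _ ↦ pruferScale k0 M ν ρ e')
        (fun x ↦ L' * (1 / leadCoeff k0 e' ks x) / pruferScale k0 M ν ρ e')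
        (fun x ↦ -(e' * ρ * km x / leadCoeff k0 e' ks x)) := by
    intro e' L' he' hL'
    have hge := pruferScale_ge (ν := ν) h he'.1 hρ
    have p1 : 0 < (ν + M / k0 * ρ) := by positivity
    have p2 : 0 < (|lam| + 1) * B₀ / ν := by positivity
    refine (h.sturmBdd he' hρ).pruferBdd (hν.trans_le hge) ?_ ?_ ?_
    · have : M / k0 * (e' * ρ) ≤ M / k0 * (1 * ρ) := by have := he'.2.1; gcongr
      unfold pruferScale
      linarith
    · have : |L'| * B₀ / pruferScale k0 M ν ρ e' ≤ (|lam| + 1) * B₀ / ν := by gcongr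
      linarith
    · linarith
  have tω : Tendsto (fun i ↦ pruferScale k0 M ν ρ (e i)) l (𝓝 (pruferScale k0 M ν ρ ε)) :=
    ((te.mul_const ρ).const_mul (M / k0)).const_add ν
  have tq : ∀ x, Tendsto (fun i ↦ leadCoeff k0 (e i) ks x) l (𝓝 (leadCoeff k0 ε ks x)) :=
    fun x ↦ ((te.mul_const (ks x)).div_const 2).const_add k0
  have q0 : ∀ x, leadCoeff k0 ε ks x ≠ 0 := fun x ↦
    ((by positivity : 0 < k0 / 2).trans_le (leadCoeff_bounds hε (h.les x)).1).ne'
  refine (h.isSturmAngle hε hρ hν lam).tendsto (by positivity) (bdd ε lam hε (by linarith))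
    (f := fun i ↦ platoonAngle k0 M ν ρ km ks (e i) (L i))
    (by filter_upwards [he] with i hi using h.isSturmAngle hi hρ hν (L i)) ?_
    (fun _ ↦ tω) (fun x ↦ ?_) (fun x ↦ ?_)
  · filter_upwards [he, tL.abs.eventually_le_const (lt_add_one |lam|)] with i hi hi'
    exact bdd _ _ hi hi'
  · exact (tL.mul (tendsto_const_nhds.div (tq x) (q0 x))).div tω
      (hν.trans_le (pruferScale_ge h hε.1 hρ)).ne'
  · exact (((te.mul_const ρ).mul_const (km x)).div (tq x) (q0 x)).neg

theorem MistuningBdd.angle_zero (h : MistuningBdd k0 M km ks) (hε : SmallMistuning k0 M ε)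
    (hρ : 0 ≤ ρ) (hν : 0 < ν) : platoonAngle k0 M ν ρ km ks ε 0 (2 * Real.pi) = 0 := by
  have hω := hν.trans_le (pruferScale_ge (ν := ν) h hε.1 hρ)
  have h0 : IsSturmAngle (2 * Real.pi) (pruferScale k0 M ν ρ ε) 0
      (fun x ↦ ε * ρ * km x / leadCoeff k0 ε ks x) (fun x ↦ 1 / leadCoeff k0 ε ks x)
      (fun _ ↦ 0) := ⟨continuous_const, fun x _ ↦ by simp [pruferField]⟩
  exact h0.eqAt (h.isSturmAngle hε hρ hν 0) (by positivity) ((h.sturmBdd hε hρ).pruferBdd' hω 0)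

/-- This explains the Prüfer scale `ω`. For this `lam` the coefficient of `cos²` is at least `ω`, so
those of `sin²` and `cos²` together contribute at least `ω`. The mixed term costs at most `(M/k₀) ε
ρ`, since `|sin cos| ≤ 1/2`. What remains of the speed is at least `ν`. -/
theorem MistuningBdd.le_angle (h : MistuningBdd k0 M km ks) (hε : SmallMistuning k0 M ε)
    (hρ : 0 ≤ ρ) (hν : 0 < ν) : 2 * Real.pi * ν ≤ platoonAngle k0 M ν ρ km ks ε
      (3 * k0 / 2 * pruferScale k0 M ν ρ ε ^ 2) (2 * Real.pi) := by
  have hk := h.k0_pos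
  have hM := h.M_pos
  have hω := hν.trans_le (pruferScale_ge (ν := ν) h hε.1 hρ)
  set lam := 3 * k0 / 2 * pruferScale k0 M ν ρ ε ^ 2 with hlam
  have hφ := h.isSturmAngle hε hρ hν lam
  rw [hφ.eq (2 * Real.pi) ⟨by positivity, le_rfl⟩]
  have : 2 * Real.pi * ν = ∫ t in (0 : ℝ)..(2 * Real.pi), ν := by simp
  rw [this]
  refine intervalIntegral.integral_mono_on (by positivity) (by simp)
    (((h.sturmBdd hε hρ).pruferBdd' hω lam).field_intervalIntegrable hφ.cont.measurable _ _)
    fun x _ ↦ ?_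
  obtain ⟨q1, q2⟩ := leadCoeff_bounds hε (h.les x)
  change k0 / 2 ≤ leadCoeff k0 ε ks x at q1
  change leadCoeff k0 ε ks x ≤ 3 * k0 / 2 at q2
  have q0 : 0 < leadCoeff k0 ε ks x := (by positivity : 0 < k0 / 2).trans_le q1
  set q := leadCoeff k0 ε ks x with hq
  set ω := pruferScale k0 M ν ρ ε with hωdef
  set s := Real.sin (platoonAngle k0 M ν ρ km ks ε lam x)
  set c := Real.cos (platoonAngle k0 M ν ρ km ks ε lam x)
  have hsc : |s * c| ≤ 1 / 2 := abs_sin_mul_cos_le _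
  have hone : s ^ 2 + c ^ 2 = 1 := Real.sin_sq_add_cos_sq _
  have hβ : ω ≤ lam * (1 / q) / ω := by
    rw [le_div_iff₀ hω, mul_one_div, le_div_iff₀ q0, hlam]
    nlinarith [sq_nonneg ω]
  have hδ := mul_nonneg hε.1 hρ
  have hp : |ε * ρ * km x / q| ≤ 2 * (M / k0 * (ε * ρ)) := by
    rw [abs_div, abs_mul, abs_of_nonneg hδ, abs_of_pos q0]
    calc ε * ρ * |km x| / q ≤ ε * ρ * M / (k0 / 2) := by
          gcongr
          exact h.lem x
      _ = _ := by field_simp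
  have hps : |ε * ρ * km x / q * (s * c)| ≤ M / k0 * (ε * ρ) := by
    rw [abs_mul]
    calc _ ≤ 2 * (M / k0 * (ε * ρ)) * (1 / 2) := by gcongr
      _ = _ := by ring
  have h1 := (abs_le.1 hps).2
  have h2 := mul_le_mul_of_nonneg_right hβ (sq_nonneg c)
  have h3 : ω = ν + M / k0 * (ε * ρ) := rfl
  change ν ≤ ω * s ^ 2 + lam * (1 / q) / ω * c ^ 2 + -(ε * ρ * km x / q) * (s * c)
  have h4 : ω * s ^ 2 + ω * c ^ 2 = ω := by rw [← mul_add, hone, mul_one]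
  linarith

theorem MistuningBdd.exists_lam (h : MistuningBdd k0 M km ks) (hε : SmallMistuning k0 M ε)
    (hρ : 0 ≤ ρ) (hν : 0 < ν) : ∃ lam, 0 < lam ∧
      lam ≤ 3 * k0 / 2 * pruferScale k0 M ν ρ ε ^ 2 ∧
      platoonAngle k0 M ν ρ km ks ε lam (2 * Real.pi) = 2 * Real.pi * ν := by
  have hk := h.k0_pos
  have hc : Continuous fun lam ↦ platoonAngle k0 M ν ρ km ks ε lam (2 * Real.pi) :=
    continuous_iff_continuousAt.2 fun lam ↦ h.angle_tendsto hε hρ hν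
      (Eventually.of_forall fun _ ↦ hε) tendsto_const_nhds tendsto_id
  have h0 := h.angle_zero hε hρ hν
  have hp : 0 < 2 * Real.pi * ν := by positivity
  obtain ⟨lam, hl, e⟩ := intermediate_value_Icc (a := (0 : ℝ))
    (b := 3 * k0 / 2 * pruferScale k0 M ν ρ ε ^ 2) (by positivity) hc.continuousOn
    (show 2 * Real.pi * ν ∈ _ from ⟨by rw [h0]; exact hp.le, h.le_angle hε hρ hν⟩)
  refine ⟨lam, lt_of_le_of_ne hl.1 ?_, hl.2, e⟩
  rintro rfl
  simp only [h0] at e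
  exact hp.ne e

/-- A function selecting the spectral parameter with a prescribed angle is continuous. -/
theorem MistuningBdd.continuousOn_lam (h : MistuningBdd k0 M km ks) {ε₁ : ℝ}
    (hε : ∀ ε ∈ Icc 0 ε₁, SmallMistuning k0 M ε) (hρ : 0 ≤ ρ) (hν : 0 < ν) {L : ℝ → ℝ} {θ : ℝ}
    (hL : ∀ ε ∈ Icc 0 ε₁, platoonAngle k0 M ν ρ km ks ε (L ε) (2 * Real.pi) = θ) :
    ContinuousOn L (Icc 0 ε₁) := by
  intro e he
  have ev : ∀ᶠ e' in 𝓝[Icc 0 ε₁] e, e' ∈ Icc 0 ε₁ := self_mem_nhdsWithin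
  have tt : ∀ a, Tendsto (fun e' ↦ platoonAngle k0 M ν ρ km ks e' a (2 * Real.pi))
      (𝓝[Icc 0 ε₁] e) (𝓝 (platoonAngle k0 M ν ρ km ks e a (2 * Real.pi))) := fun a ↦
    h.angle_tendsto (hε e he) hρ hν (ev.mono hε) (tendsto_id.mono_left nhdsWithin_le_nhds)
      tendsto_const_nhds
  -- If `a < L e`, the angle at `(e, a)` is below `θ`; this persists for nearby `e'`, and
  -- monotonicity turns it back into `a < L e'`. The other side is symmetric.
  refine tendsto_order.2 ⟨fun a ha ↦ ?_, fun a ha ↦ ?_⟩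
  · have h1 := h.angle_strictMono (hε e he) hρ hν ha
    simp only [hL e he] at h1
    filter_upwards [(tt a).eventually_lt_const h1, ev] with e' h2 h3
    rw [← hL e' h3] at h2
    exact (h.angle_strictMono (hε e' h3) hρ hν).lt_iff_lt.1 h2
  · have h1 := h.angle_strictMono (hε e he) hρ hν ha
    simp only [hL e he] at h1
    filter_upwards [(tt a).eventually_const_lt h1, ev] with e' h2 h3
    rw [← hL e' h3] at h2
    exact (h.angle_strictMono (hε e' h3) hρ hν).lt_iff_lt.1 h2

/-- Without mistuning the scale is `ν` and the field is identically `ν` along `φ(x) = ν x`. -/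
theorem MistuningBdd.angle_nominal (h : MistuningBdd k0 M km ks) (hρ : 0 ≤ ρ) (hν : 0 < ν) :
    platoonAngle k0 M ν ρ km ks 0 (k0 * ν ^ 2) (2 * Real.pi) = 2 * Real.pi * ν := by
  have hk := h.k0_pos
  have hε : SmallMistuning k0 M 0 := ⟨le_rfl, zero_le_one, by simpa using hk.le⟩
  have e0 : pruferScale k0 M ν ρ 0 = ν := by simp [pruferScale]
  have e1 : ∀ x, leadCoeff k0 0 ks x = k0 := fun x ↦ by simp [leadCoeff]
  have h0 : IsSturmAngle (2 * Real.pi) (pruferScale k0 M ν ρ 0) (k0 * ν ^ 2)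
      (fun x ↦ 0 * ρ * km x / leadCoeff k0 0 ks x) (fun x ↦ 1 / leadCoeff k0 0 ks x)
      (fun x ↦ ν * x) := by
    refine ⟨by fun_prop, fun x _ ↦ ?_⟩
    have : ∀ t, pruferField (fun _ ↦ pruferScale k0 M ν ρ 0)
        (fun x ↦ k0 * ν ^ 2 * (1 / leadCoeff k0 0 ks x) / pruferScale k0 M ν ρ 0)
        (fun x ↦ -(0 * ρ * km x / leadCoeff k0 0 ks x)) t (ν * t) = ν := fun t ↦ by
      simp only [pruferField, e0, e1]
      have : k0 * ν ^ 2 * (1 / k0) / ν = ν := by field_simp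
      rw [this]
      linear_combination ν * Real.sin_sq_add_cos_sq (ν * t)
    simp only [this, intervalIntegral.integral_const, sub_zero, smul_eq_mul]
    ring
  have := h0.eqAt (h.isSturmAngle hε hρ hν (k0 * ν ^ 2)) (by positivity)
    ((h.sturmBdd hε hρ).pruferBdd' (hν.trans_le (pruferScale_ge h le_rfl hρ)) _)
  rw [this]; ring

end Platoon

/-! ### Expansion of the angle and of the spectral parameter in `δ = ε ρ`. -/

section Asymptotics

open Filter Topology

variable {k0 M ν ρ ε lam : ℝ} {km ks : ℝ → ℝ}

/-- First-order expansion of the coefficients of the Prüfer equation. -/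
theorem exists_coeff_expansion {C₂ : ℝ} (hk : 0 < k0) (hM : 0 < M) (hν : 0 < ν) (hC₂ : 0 ≤ C₂) :
    ∃ C, 0 ≤ C ∧ ∀ ε δ Λ k s : ℝ, SmallMistuning k0 M ε → 0 ≤ δ → δ ≤ 1 → |k| ≤ M → |s| ≤ M →
      |Λ| ≤ C₂ * δ →
      |(k0 * ν ^ 2 + Λ) * (1 / (k0 + ε * s / 2)) / (ν + M / k0 * δ) -
          (ν - M / k0 * δ + Λ / (ν * k0))| ≤ C * (δ ^ 2 + ε) ∧
      |δ * k / (k0 + ε * s / 2) - δ * k / k0| ≤ C * (δ ^ 2 + ε) := by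
  set K := M / k0 with hK
  have hK0 : 0 < K := by positivity
  set a := (k0 * ν ^ 2 + C₂) * M / (ν * k0 ^ 2) with ha
  set b := (K ^ 2 + K * C₂ / (ν * k0)) / ν with hb
  set d := M ^ 2 / k0 ^ 2 with hd
  have ha0 : 0 ≤ a := by positivity
  have hb0 : 0 ≤ b := by positivity
  have hd0 : 0 ≤ d := by positivity
  refine ⟨a + b + d, by positivity, fun ε δ Λ k s hε hδ hδ1 hk' hs hΛ ↦ ?_⟩
  obtain ⟨q1, -⟩ := leadCoeff_bounds hε hs
  set q := k0 + ε * s / 2 with hq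
  have q0 : 0 < q := (by positivity : 0 < k0 / 2).trans_le q1
  have hε0 := hε.1
  have hω : ν ≤ ν + K * δ := by have : 0 ≤ K * δ := by positivity
                                linarith
  set ω := ν + K * δ with hωd
  have hω0 : 0 < ω := hν.trans_le hω
  have hkq : |k0 - q| ≤ ε * M / 2 := by
    rw [show k0 - q = -(ε * s / 2) by rw [hq]; ring, abs_neg, abs_div, abs_mul,
      abs_of_nonneg hε0, abs_two]
    gcongr
  have hδ2 : 0 ≤ δ ^ 2 := sq_nonneg δ
  constructor
  -- The first summand is the error of replacing `q` by `k₀`, of order `ε`; the second is the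
  -- remainder of `1/(ν + K δ)`, of order `δ²`.
  · have e : (k0 * ν ^ 2 + Λ) * (1 / q) / ω - (ν - K * δ + Λ / (ν * k0)) =
        (k0 * ν ^ 2 + Λ) * (k0 - q) / (ω * q * k0) +
          (K ^ 2 * δ ^ 2 - K * δ * Λ / (ν * k0)) / ω := by
      have : ω ≠ 0 := hω0.ne'
      field_simp
      rw [hωd]
      ring
    have b1 : |(k0 * ν ^ 2 + Λ) * (k0 - q) / (ω * q * k0)| ≤ a * ε := by
      rw [abs_div, abs_mul, abs_of_pos (by positivity : 0 < ω * q * k0)]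
      have : |k0 * ν ^ 2 + Λ| ≤ k0 * ν ^ 2 + C₂ := by
        refine (abs_add_le _ _).trans ?_
        rw [abs_of_pos (by positivity : 0 < k0 * ν ^ 2)]
        have := mul_le_mul_of_nonneg_left hδ1 hC₂
        linarith
      calc _ ≤ (k0 * ν ^ 2 + C₂) * (ε * M / 2) / (ν * (k0 / 2) * k0) := by gcongr
        _ = _ := by rw [ha]; field_simp
    have b2 : |(K ^ 2 * δ ^ 2 - K * δ * Λ / (ν * k0)) / ω| ≤ b * δ ^ 2 := by
      rw [abs_div, abs_of_pos hω0]
      have : |K ^ 2 * δ ^ 2 - K * δ * Λ / (ν * k0)| ≤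
          K ^ 2 * δ ^ 2 + K * δ * (C₂ * δ) / (ν * k0) := by
        refine (abs_sub _ _).trans ?_
        rw [abs_of_nonneg (by positivity : 0 ≤ K ^ 2 * δ ^ 2), abs_div, abs_mul,
          abs_of_nonneg (by positivity : 0 ≤ K * δ), abs_of_pos (by positivity : 0 < ν * k0)]
        gcongr
      calc _ ≤ (K ^ 2 * δ ^ 2 + K * δ * (C₂ * δ) / (ν * k0)) / ν := by gcongr
        _ = _ := by rw [hb]; ring
    rw [e]
    refine (abs_add_le _ _).trans ?_
    have : 0 ≤ a * δ ^ 2 + b * ε + d * (δ ^ 2 + ε) := by positivity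
    linarith
  · have e : δ * k / q - δ * k / k0 = δ * k * (k0 - q) / (q * k0) := by
      field_simp
    rw [e, abs_div, abs_mul, abs_mul, abs_of_nonneg hδ, abs_of_pos (by positivity : 0 < q * k0)]
    have : δ * |k| * |k0 - q| / (q * k0) ≤ d * ε := by
      calc _ ≤ 1 * M * (ε * M / 2) / (k0 / 2 * k0) := by gcongr
        _ = _ := by rw [hd]; field_simp
    have : 0 ≤ (a + b) * (δ ^ 2 + ε) + d * δ ^ 2 := by positivity
    linarith

theorem integral_cos_two_mul {ν : ℝ} (hν : 0 < ν) (h4 : Real.sin (4 * Real.pi * ν) = 0) :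
    ∫ t in (0 : ℝ)..(2 * Real.pi), Real.cos (2 * ν * t) = 0 := by
  rw [intervalIntegral.integral_comp_mul_left (fun t ↦ Real.cos t) (by positivity)]
  simp only [integral_cos, mul_zero, Real.sin_zero, sub_zero]
  rw [show 2 * ν * (2 * Real.pi) = 4 * Real.pi * ν by ring, h4, smul_zero]

theorem integral_cos_sq_mul {ν : ℝ} (hν : 0 < ν) (h4 : Real.sin (4 * Real.pi * ν) = 0) :
    ∫ t in (0 : ℝ)..(2 * Real.pi), Real.cos (ν * t) ^ 2 = Real.pi := by
  have e : ∀ t, Real.cos (ν * t) ^ 2 = 1 / 2 + Real.cos (2 * ν * t) / 2 := fun t ↦ by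
    rw [Real.cos_sq, ← mul_assoc]
  simp_rw [e]
  rw [intervalIntegral.integral_add (by simp)
    ((by fun_prop : Continuous fun t : ℝ ↦ Real.cos (2 * ν * t) / 2).intervalIntegrable _ _),
    intervalIntegral.integral_div (f := fun t ↦ Real.cos (2 * ν * t)),
    integral_cos_two_mul hν h4]
  simp only [intervalIntegral.integral_const, sub_zero, smul_eq_mul, zero_div, add_zero]
  ring

/-- First-order expansion of the Prüfer angle at `2π` near the nominal eigenvalue. -/
theorem MistuningBdd.exists_angle_expansion (h : MistuningBdd k0 M km ks) (hν : 0 < ν)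
    (h4 : Real.sin (4 * Real.pi * ν) = 0) {C₂ : ℝ} (hC₂ : 0 ≤ C₂) :
    ∃ C, 0 ≤ C ∧ ∀ ε ρ Λ : ℝ, SmallMistuning k0 M ε → 1 ≤ ρ → ε * ρ ≤ 1 →
      |Λ| ≤ C₂ * (ε * ρ) →
      |platoonAngle k0 M ν ρ km ks ε (k0 * ν ^ 2 + Λ) (2 * Real.pi) - 2 * Real.pi * ν -
        (Λ * Real.pi / (ν * k0) - ε * ρ / (2 * k0) *
          ∫ t in (0 : ℝ)..(2 * Real.pi), km t * Real.sin (2 * ν * t))| ≤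
      C * ((ε * ρ) ^ 2 + ε) := by
  have hk := h.k0_pos
  have hM := h.M_pos
  have hπ := Real.pi_pos
  obtain ⟨C₁, hC₁, hexp⟩ := exists_coeff_expansion hk hM hν hC₂
  set K := M / k0 with hK
  have hK0 : 0 < K := by positivity
  set C₃ := K + (C₂ / (ν * k0) + K) + K with hC₃
  have hC₃0 : 0 ≤ C₃ := by positivity
  set D := 2 * Real.pi * (4 * C₁ + C₃) with hD
  have hD0 : 0 ≤ D := by positivity
  refine ⟨2 * Real.pi * (2 * C₁ + C₃ * D), by positivity, fun ε ρ Λ hε hρ hδ1 hΛ ↦ ?_⟩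
  have hε0 := hε.1
  have hρ0 : 0 ≤ ρ := zero_le_one.trans hρ
  set δ := ε * ρ with hδ
  have hδ0 : 0 ≤ δ := by positivity
  have hεδ : ε ≤ δ := le_mul_of_one_le_right hε0 hρ
  have hδδ : δ ^ 2 + ε ≤ 2 * δ := by
    have : δ ^ 2 ≤ δ := by rw [sq]; exact mul_le_of_le_one_left hδ0 hδ1
    linarith
  set lam := k0 * ν ^ 2 + Λ with hlam
  set φ := platoonAngle k0 M ν ρ km ks ε lam with hφd
  have hφ : IsSturmAngle _ _ _ _ _ φ := h.isSturmAngle hε hρ0 hν lam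
  have hbd := (h.sturmBdd hε hρ0).pruferBdd' (hν.trans_le (pruferScale_ge h hε0 hρ0)) lam
  have hφm := hφ.cont.measurable
  set f : ℝ → ℝ := fun t ↦ pruferField (fun _ ↦ pruferScale k0 M ν ρ ε)
    (fun x ↦ lam * (1 / leadCoeff k0 ε ks x) / pruferScale k0 M ν ρ ε)
    (fun x ↦ -(ε * ρ * km x / leadCoeff k0 ε ks x)) t (φ t) with hf
  have fi : ∀ a b, IntervalIntegrable f volume a b := hbd.field_intervalIntegrable hφm
  -- First-order part of the field beyond the constant speed `ν`. It is of size `δ` and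
  -- `O(δ)`-Lipschitz in the angle; since `φ(t) - ν t = O(δ)`, replacing `φ(t)` by `ν t` in it costs
  -- only `O(δ²)`.
  let G : ℝ → ℝ → ℝ := pruferField (fun _ ↦ K * δ) (fun _ ↦ Λ / (ν * k0) - K * δ)
    (fun t ↦ -(δ * km t / k0))
  have bK : |K * δ| ≤ K * δ := by rw [abs_of_nonneg (by positivity)]
  have bβ : |Λ / (ν * k0) - K * δ| ≤ (C₂ / (ν * k0) + K) * δ := by
    refine (abs_sub _ _).trans ?_
    rw [abs_div, abs_of_pos (by positivity : 0 < ν * k0)]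
    have : |Λ| / (ν * k0) ≤ C₂ * δ / (ν * k0) := by gcongr
    calc _ ≤ C₂ * δ / (ν * k0) + K * δ := add_le_add this bK
      _ = _ := by ring
  have bγ : ∀ t, |-(δ * km t / k0)| ≤ K * δ := fun t ↦ by
    rw [abs_neg, abs_div, abs_mul, abs_of_nonneg hδ0, abs_of_pos hk]
    calc _ ≤ δ * M / k0 := by gcongr; exact h.lem t
      _ = _ := by rw [hK]; ring
  have bG : PruferBdd (C₃ * δ) (fun _ ↦ K * δ) (fun _ ↦ Λ / (ν * k0) - K * δ)
      (fun t ↦ -(δ * km t / k0)) := by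
    have c1 : 0 ≤ C₂ / (ν * k0) := by positivity
    refine ⟨measurable_const, measurable_const, ((h.measm.const_mul δ).div_const k0).neg,
      fun _ ↦ bK.trans ?_, fun _ ↦ bβ.trans ?_, fun t ↦ (bγ t).trans ?_⟩ <;>
    · gcongr
      rw [hC₃]
      linarith
  have Gle : ∀ t a, |G t a| ≤ C₃ * δ := fun t a ↦ by
    have := abs_three_le (D := 1) bK bβ (bγ t)
      (by rw [abs_of_nonneg (sin_sq_mem a).1]; exact (sin_sq_mem a).2)
      (by rw [abs_of_nonneg (cos_sq_mem a).1]; exact (cos_sq_mem a).2)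
      ((abs_sin_mul_cos_le a).trans (by norm_num))
    exact this.trans_eq (by rw [hC₃]; ring)
  have Glip : ∀ t a b, |G t a - G t b| ≤ C₃ * δ * |a - b| := fun t a b ↦ by
    have := abs_three_le bK bβ (bγ t) (abs_sin_sq_sub_le a b)
      (abs_cos_sq_sub_le a b) (abs_sin_mul_cos_sub_le a b)
    refine le_of_eq_of_le ?_ (this.trans_eq (by rw [hC₃]; ring))
    congr 1
    simp only [G, pruferField]; ring
  have fG : ∀ t, |f t - ν - G t (φ t)| ≤ 2 * C₁ * (δ ^ 2 + ε) := fun t ↦ by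
    obtain ⟨r1, r2⟩ := hexp ε δ Λ (km t) (ks t) hε hδ0 hδ1 (h.lem t) (h.les t) hΛ
    have e : f t - ν - G t (φ t) =
        0 * 0 + (lam * (1 / (k0 + ε * ks t / 2)) / (ν + K * δ) - (ν - K * δ + Λ / (ν * k0))) *
          Real.cos (φ t) ^ 2 + (δ * km t / (k0 + ε * ks t / 2) - δ * km t / k0) *
            -(Real.sin (φ t) * Real.cos (φ t)) := by
      simp only [hf, G, pruferField, pruferScale, leadCoeff]
      linear_combination (ν * Real.sin_sq_add_cos_sq (φ t))
    rw [e]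
    refine (abs_three_le (D := 1) (X := 0) (by simp) r1 r2 (by simp)
      (by rw [abs_of_nonneg (cos_sq_mem _).1]; exact (cos_sq_mem _).2)
      (by rw [abs_neg]; exact (abs_sin_mul_cos_le _).trans (by norm_num))).trans_eq (by ring)
  have fν : ∀ t, |f t - ν| ≤ (4 * C₁ + C₃) * δ := fun t ↦ by
    have e : f t - ν = (f t - ν - G t (φ t)) + G t (φ t) := by ring
    rw [e]
    refine (abs_add_le _ _).trans ?_
    have := mul_le_mul_of_nonneg_left hδδ (by positivity : 0 ≤ 2 * C₁)
    linarith [fG t, Gle t (φ t)]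
  have hint : ∀ x ∈ Icc 0 (2 * Real.pi), φ x - ν * x = ∫ t in (0 : ℝ)..x, (f t - ν) := by
    intro x hx
    rw [hφ.eq x hx, intervalIntegral.integral_sub (fi 0 x) (by simp)]
    simp [mul_comm, hf]
  have hclose : ∀ x ∈ Icc 0 (2 * Real.pi), |φ x - ν * x| ≤ D * δ := by
    intro x hx
    rw [hint x hx]
    have := intervalIntegral.norm_integral_le_of_norm_le_const (f := fun t ↦ f t - ν) (a := 0)
      (b := x) (fun t _ ↦ fν t)
    rw [sub_zero, abs_of_nonneg hx.1] at this
    calc _ ≤ (4 * C₁ + C₃) * δ * x := this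
      _ ≤ (4 * C₁ + C₃) * δ * (2 * Real.pi) := by gcongr; exact hx.2
      _ = _ := by rw [hD]; ring
  have gi : IntervalIntegrable (fun t ↦ G t (ν * t)) volume 0 (2 * Real.pi) :=
    bG.field_intervalIntegrable (by fun_prop) _ _
  -- The artificial scale enters as `K δ (sin² - cos²) = -K δ cos (2νt)`, whose integral vanishes,
  -- so it leaves no trace at first order.
  have main : ∫ t in (0 : ℝ)..(2 * Real.pi), G t (ν * t) = Λ * Real.pi / (ν * k0) - δ / (2 * k0) *
      ∫ t in (0 : ℝ)..(2 * Real.pi), km t * Real.sin (2 * ν * t) := by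
    have e : ∀ t, G t (ν * t) = (-(K * δ)) * Real.cos (2 * ν * t) +
        Λ / (ν * k0) * Real.cos (ν * t) ^ 2 - δ / (2 * k0) * (km t * Real.sin (2 * ν * t)) := by
      intro t
      simp only [G, pruferField]
      rw [mul_assoc 2 ν t, Real.cos_two_mul, Real.sin_two_mul]
      have : Real.sin (ν * t) ^ 2 = 1 - Real.cos (ν * t) ^ 2 := by
        linarith [Real.sin_sq_add_cos_sq (ν * t)]
      rw [this]
      field_simp
      ring
    have i1 : IntervalIntegrable (fun t ↦ (-(K * δ)) * Real.cos (2 * ν * t)) volume 0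
        (2 * Real.pi) := Continuous.intervalIntegrable (by fun_prop) _ _
    have i2 : IntervalIntegrable (fun t ↦ Λ / (ν * k0) * Real.cos (ν * t) ^ 2) volume 0
        (2 * Real.pi) := Continuous.intervalIntegrable (by fun_prop) _ _
    have i3 : IntervalIntegrable (fun t ↦ δ / (2 * k0) * (km t * Real.sin (2 * ν * t))) volume 0
        (2 * Real.pi) :=
      ((intervalIntegrable_of_bdd h.measm h.lem _ _).mul_continuousOn
        (Continuous.continuousOn (by fun_prop))).const_mul _
    simp_rw [e]
    rw [intervalIntegral.integral_sub (i1.add i2) i3, intervalIntegral.integral_add i1 i2,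
      intervalIntegral.integral_const_mul, intervalIntegral.integral_const_mul,
      intervalIntegral.integral_const_mul, integral_cos_two_mul hν h4,
      integral_cos_sq_mul hν h4]
    ring
  have e2 := hint (2 * Real.pi) ⟨by positivity, le_rfl⟩
  rw [mul_comm ν] at e2
  rw [e2, ← main, ← intervalIntegral.integral_sub ((fi _ _).sub (by simp)) gi]
  have := intervalIntegral.norm_integral_le_of_norm_le_const (a := 0) (b := 2 * Real.pi)
    (f := fun t ↦ f t - ν - G t (ν * t)) (C := (2 * C₁ + C₃ * D) * (δ ^ 2 + ε)) (fun t ht ↦ ?_)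
  · rw [sub_zero, abs_of_pos (by positivity)] at this
    exact this.trans_eq (by ring)
  · rw [uIoc_of_le (by positivity)] at ht
    have e : f t - ν - G t (ν * t) = (f t - ν - G t (φ t)) + (G t (φ t) - G t (ν * t)) := by ring
    rw [e]
    refine (norm_add_le _ _).trans ?_
    have l1 := fG t
    have l2 := (Glip t (φ t) (ν * t)).trans
      (mul_le_mul_of_nonneg_left (hclose t ⟨ht.1.le, ht.2⟩) (by positivity))
    have l3 : 0 ≤ C₃ * D * ε := by positivity
    simp only [Real.norm_eq_abs]
    linarith

/-- The spectral parameter is `k₀ ν² + c ε ρ + O((ε ρ)² + ε)`. -/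
theorem MistuningBdd.exists_lam_expansion (h : MistuningBdd k0 M km ks) (hν : 0 < ν)
    (h4 : Real.sin (4 * Real.pi * ν) = 0) :
    ∃ C R, 0 ≤ C ∧ 1 ≤ R ∧ ∀ ε ρ lam : ℝ, SmallMistuning k0 M ε → R ≤ ρ →
      0 < lam → lam ≤ 3 * k0 / 2 * pruferScale k0 M ν ρ ε ^ 2 →
      platoonAngle k0 M ν ρ km ks ε lam (2 * Real.pi) = 2 * Real.pi * ν →
      |lam - k0 * ν ^ 2 - ε * ρ * (ν / (2 * Real.pi) *
          ∫ t in (0 : ℝ)..(2 * Real.pi), km t * Real.sin (2 * ν * t))| ≤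
        C * ((ε * ρ) ^ 2 + ε) := by
  have hk := h.k0_pos
  have hM := h.M_pos
  have hπ := Real.pi_pos
  set I := ∫ t in (0 : ℝ)..(2 * Real.pi), km t * Real.sin (2 * ν * t) with hI
  set c := ν / (2 * Real.pi) * I with hc
  obtain ⟨C, hC, hexp⟩ := h.exists_angle_expansion hν h4 (C₂ := |c| + 1) (by positivity)
  set K := M / k0 with hK
  have hK0 : 0 < K := by positivity
  -- Shifting `lam` by `B (δ² + ε)` moves the linearized angle by `(C + 1)(δ² + ε)`, which beats the
  -- error `C (δ² + ε)`. The bounds `δ ≤ d` and `2B ≤ ρ` keep the shift below `δ`, so the constant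
  -- `|c| + 1` above admits both trial values.
  set B := (C + 1) * ν * k0 / Real.pi with hB
  have hB0 : 0 < B := by positivity
  set d := min 1 (1 / (2 * B)) with hd
  have hd0 : 0 < d := by positivity
  set C' := 3 * k0 / 2 * (ν / d + K) ^ 2 + k0 * ν ^ 2 / d ^ 2 + |c| / d with hC'
  refine ⟨B + C', max 1 (2 * B), by positivity, le_max_left _ _,
    fun ε ρ lam hε hρ hl0 hl1 hang ↦ ?_⟩
  have hρ1 : 1 ≤ ρ := (le_max_left _ _).trans hρ
  have hρB : 2 * B ≤ ρ := (le_max_right _ _).trans hρ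
  have hε0 := hε.1
  have hρ0 : 0 ≤ ρ := zero_le_one.trans hρ1
  have hmono := h.angle_strictMono hε hρ0 hν
  have hC'0 : 0 ≤ C' := by positivity
  unfold pruferScale at hl1
  rw [← hK] at hl1
  set δ := ε * ρ with hδ
  have hδ0 : 0 ≤ δ := by positivity
  have hnn : 0 ≤ δ ^ 2 + ε := by positivity
  rcases le_or_gt δ d with hsmall | hlarge
  · have hδ1 : δ ≤ 1 := hsmall.trans (min_le_left _ _)
    have hBd : B * δ ≤ 1 / 2 := by
      calc B * δ ≤ B * (1 / (2 * B)) := by gcongr; exact hsmall.trans (min_le_right _ _)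
        _ = 1 / 2 := by field_simp
    have hBε : B * ε ≤ δ / 2 := by
      have := mul_le_mul_of_nonneg_left hρB hε0
      linarith
    have hBs : B * (δ ^ 2 + ε) ≤ δ := by
      have := mul_le_mul_of_nonneg_right hBd hδ0
      linarith [this, show B * (δ ^ 2 + ε) = B * δ * δ + B * ε by ring]
    have bnd : ∀ s : ℝ, |s| ≤ 1 → |δ * c + s * (B * (δ ^ 2 + ε))| ≤ (|c| + 1) * δ := by
      intro s hs
      refine (abs_add_le _ _).trans ?_
      rw [abs_mul δ c, abs_mul s, abs_of_nonneg hδ0,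
        abs_of_nonneg (by positivity : 0 ≤ B * (δ ^ 2 + ε))]
      have : |s| * (B * (δ ^ 2 + ε)) ≤ 1 * δ := by gcongr
      linarith
    have val : ∀ s : ℝ, (δ * c + s * (B * (δ ^ 2 + ε))) * Real.pi / (ν * k0) - δ / (2 * k0) * I =
        s * ((C + 1) * (δ ^ 2 + ε)) := by
      intro s
      rw [hc, hB]
      field_simp
      ring
    have up := hexp ε ρ _ hε hρ1 hδ1 (bnd 1 (by simp))
    have lo := hexp ε ρ _ hε hρ1 hδ1 (bnd (-1) (by simp))
    rw [val] at up lo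
    have up' := (abs_le.1 up).1
    have lo' := (abs_le.1 lo).2
    -- The trial angles lie on either side of `2πν`, so strict monotonicity traps `lam` between the
    -- trial values.
    have r1 : lam ≤ k0 * ν ^ 2 + (δ * c + 1 * (B * (δ ^ 2 + ε))) := by
      refine hmono.le_iff_le.1 ?_
      simp only [hang]
      linarith
    have r2 : k0 * ν ^ 2 + (δ * c + (-1) * (B * (δ ^ 2 + ε))) ≤ lam := by
      refine hmono.le_iff_le.1 ?_
      simp only [hang]
      linarith
    have : 0 ≤ C' * (δ ^ 2 + ε) := by positivity
    rw [abs_le]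
    constructor <;> linarith
  -- For `δ > d` nothing need cancel: `lam`, `k₀ν²` and `δ c` are each bounded by a multiple of
  -- `δ²`.
  · have hr : 1 ≤ δ / d := (one_le_div hd0).2 hlarge.le
    have t1 : 3 * k0 / 2 * (ν + K * δ) ^ 2 ≤ 3 * k0 / 2 * (ν / d + K) ^ 2 * δ ^ 2 := by
      rw [mul_assoc, ← mul_pow]
      have : ν ≤ ν * (δ / d) := le_mul_of_one_le_right hν.le hr
      have : ν + K * δ ≤ (ν / d + K) * δ := by
        calc _ ≤ ν * (δ / d) + K * δ := by linarith
          _ = _ := by ring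
      gcongr
    have t2 : k0 * ν ^ 2 ≤ k0 * ν ^ 2 / d ^ 2 * δ ^ 2 := by
      calc _ ≤ k0 * ν ^ 2 * (δ / d) ^ 2 :=
            le_mul_of_one_le_right (by positivity) (one_le_pow₀ hr)
        _ = _ := by ring
    have t3 : |δ * c| ≤ |c| / d * δ ^ 2 := by
      rw [abs_mul δ c, abs_of_nonneg hδ0]
      calc _ ≤ δ * |c| * (δ / d) := le_mul_of_one_le_right (by positivity) hr
        _ = _ := by ring
    have t4 := abs_le.1 t3
    have t5 : C' * δ ^ 2 = 3 * k0 / 2 * (ν / d + K) ^ 2 * δ ^ 2 + k0 * ν ^ 2 / d ^ 2 * δ ^ 2 +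
      |c| / d * δ ^ 2 := by rw [hC']; ring
    have t6 : 0 ≤ B * (δ ^ 2 + ε) + C' * ε := by positivity
    have t7 : 0 ≤ k0 * ν ^ 2 := by positivity
    have t8 : 0 ≤ 3 * k0 / 2 * (ν / d + K) ^ 2 * δ ^ 2 := by positivity
    have t9 : 0 ≤ |c| / d * δ ^ 2 := by positivity
    have t10 : 0 ≤ k0 * ν ^ 2 / d ^ 2 * δ ^ 2 := by positivity
    rw [abs_le]
    constructor <;> linarith

end Asymptotics

/-! ### Eigenvalues as roots of a quadratic, and uniqueness of branches. -/

section Branches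

open Filter Topology

variable {b0 k0 M ν ε lam : ℝ} {km ks km' ks' : ℝ → ℝ} {N : ℕ} {s : ℂ}

/-- An essentially bounded profile agrees almost everywhere with a bounded measurable one. -/
theorem exists_bdd_representative {f : ℝ → ℝ} {μ : Measure ℝ} (hf : MemLp f ⊤ μ) :
    ∃ M₀, ∀ M ≥ M₀, ∃ g : ℝ → ℝ, Measurable g ∧ (∀ x, |g x| ≤ M) ∧ f =ᵐ[μ] g := by
  refine ⟨(eLpNormEssSup f μ).toReal, fun M hM ↦ ?_⟩
  have hM0 : 0 ≤ M := ENNReal.toReal_nonneg.trans hM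
  have hfin : eLpNormEssSup f μ ≠ ⊤ := by
    have := hf.2
    rw [eLpNorm_exponent_top] at this
    exact this.ne
  have hm := hf.1.stronglyMeasurable_mk.measurable
  -- Truncation changes the measurable representative only on a null set. Allowing every large `M`
  -- gives both profiles a common bound.
  refine ⟨fun x ↦ max (-M) (min M (hf.1.mk f x)), by fun_prop, fun x ↦ ?_, ?_⟩
  · rw [abs_le]
    exact ⟨le_max_left _ _, max_le (by linarith) (min_le_left _ _)⟩
  · filter_upwards [hf.1.ae_eq_mk, ae_le_eLpNormEssSup (f := f) (μ := μ)] with x h1 h2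
    have h3 : |f x| ≤ M := by
      refine le_trans ?_ hM
      have := ENNReal.toReal_mono hfin h2
      simpa using this
    rw [← h1]
    obtain ⟨h4, h5⟩ := abs_le.1 h3
    rw [min_eq_right h5, max_eq_right h4]

/-- An eigenvalue `s` has a real spectral parameter `-ρ² (s² + b₀ s)`, at which the Prüfer angle
is an odd multiple of `π / 2`. -/
theorem MistuningBdd.exists_lam_of_eigenvalue (h : MistuningBdd k0 M km' ks')
    (hm : km =ᵐ[platoonMeasure] km') (hs : ks =ᵐ[platoonMeasure] ks')
    (hε : SmallMistuning k0 M ε) (hρ : 0 < meanDensity N) (hν : 0 < ν)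
    (he : IsEigenvalueND b0 k0 km ks N ε s) :
    ∃ lam : ℝ, (lam : ℂ) = -(meanDensity N : ℂ) ^ 2 * (s ^ 2 + b0 * s) ∧
      Real.cos (platoonAngle k0 M ν (meanDensity N) km' ks' ε lam (2 * Real.pi)) = 0 := by
  have hk := h.k0_pos
  have hπ := Real.pi_pos
  have hT : (0 : ℝ) < 2 * Real.pi := by positivity
  obtain ⟨η, η', η'', H, n0, d0, hne, hode⟩ := he
  set ρ := meanDensity N with hρd
  have hsb := h.sturmBdd hε hρ.le
  have i2 : IntervalIntegrable η'' volume 0 (2 * Real.pi) := by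
    rw [intervalIntegrable_iff_integrableOn_Icc_of_le hT.le]
    have : IsFiniteMeasure platoonMeasure := by unfold platoonMeasure; infer_instance
    exact H.memLp.integrable (by norm_num)
  have p2 : IsPrimitiveOn (2 * Real.pi) η' η'' := .of_integral hT.le i2 H.deriv_eq
  have p1 : IsPrimitiveOn (2 * Real.pi) η η' := .of_integral hT.le
    (ContinuousOn.intervalIntegrable (by
      rw [uIcc_of_le hT.le]; exact p2.continuousOn hT.le)) H.eq
  set μ : ℂ := -(ρ : ℂ) ^ 2 * (s ^ 2 + b0 * s) with hμ
  have hode' : ∀ᵐ x, x ∈ Icc 0 (2 * Real.pi) → η'' x =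
      -((ε * ρ * km' x / leadCoeff k0 ε ks' x : ℝ) : ℂ) * η' x -
        μ * ((1 / leadCoeff k0 ε ks' x : ℝ) : ℂ) * η x := by
    have := hode.and (hm.and hs)
    rw [platoonMeasure, ae_restrict_iff' measurableSet_Icc] at this
    filter_upwards [this] with x hx hx'
    obtain ⟨e, em, es⟩ := hx hx'
    have q0 : (0 : ℝ) < leadCoeff k0 ε ks' x :=
      (by positivity : 0 < k0 / 2).trans_le (leadCoeff_bounds hε (h.les x)).1
    have q0' : ((leadCoeff k0 ε ks' x : ℝ) : ℂ) ≠ 0 := by exact_mod_cast q0.ne'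
    have ρ0 : (ρ : ℂ) ≠ 0 := by exact_mod_cast hρ.ne'
    have hq : ((leadCoeff k0 ε ks' x : ℝ) : ℂ) = k0 + ε * ks' x / 2 := by
      simp [leadCoeff]
    rw [em, es, waveSpeedSq, ← hρd] at e
    push_cast at e ⊢
    have key : -μ * η x = (leadCoeff k0 ε ks' x : ℂ) * η'' x + ε * ρ * km' x * η' x := by
      rw [hq, hμ]
      field_simp at e
      linear_combination (1 / 2) * e
    field_simp
    linear_combination -key
  have hmix : IsMixedEigenfunction (2 * Real.pi) (fun x ↦ ε * ρ * km' x / leadCoeff k0 ε ks' x)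
      (fun x ↦ 1 / leadCoeff k0 ε ks' x) μ η η' η'' :=
    ⟨p1, p2, n0, d0, hne, by
      filter_upwards [hode'] with x hx hx' using hx (Ioc_subset_Icc_self hx')⟩
  have him := hmix.im_eq_zero hT hsb
  have hre : ((μ.re : ℝ) : ℂ) = μ := Complex.ext (by simp) (by simp [him])
  refine ⟨μ.re, hre, ?_⟩
  rw [← hre] at hmix
  exact hmix.cos_eq_zero hT.le hsb (hν.trans_le (pruferScale_ge h hε.1 hρ.le))
    (h.isSturmAngle hε hρ.le hν _)

/-- The converse of `MistuningBdd.exists_lam_of_eigenvalue`. -/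
theorem MistuningBdd.isEigenvalueND (h : MistuningBdd k0 M km' ks')
    (hm : km =ᵐ[platoonMeasure] km') (hs : ks =ᵐ[platoonMeasure] ks')
    (hε : SmallMistuning k0 M ε) (hρ : 0 < meanDensity N) (hν : 0 < ν)
    (hlam : (lam : ℂ) = -(meanDensity N : ℂ) ^ 2 * (s ^ 2 + b0 * s))
    (hcos : Real.cos (platoonAngle k0 M ν (meanDensity N) km' ks' ε lam (2 * Real.pi)) = 0) :
    IsEigenvalueND b0 k0 km ks N ε s := by
  have hk := h.k0_pos
  have hT : (0 : ℝ) < 2 * Real.pi := Real.two_pi_pos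
  set ρ := meanDensity N with hρd
  have hsb := h.sturmBdd hε hρ.le
  obtain ⟨y, y', cy, cy', hy⟩ := (h.isSturmAngle hε hρ.le hν lam).exists_isMixedEigenfunction
    hT.le hsb (hν.trans_le (pruferScale_ge h hε.1 hρ.le)) hcos
  refine ⟨_, _, _, ⟨?_, hy.prim'.eq_add_integral, hy.prim.eq_add_integral⟩, hy.neumann,
    hy.dirichlet, hy.ne_zero, ?_⟩
  · have : IsFiniteMeasure platoonMeasure := by unfold platoonMeasure; infer_instance
    obtain ⟨C, hC⟩ := isCompact_Icc.exists_bound_of_continuousOn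
      (cy.continuousOn (s := Icc 0 (2 * Real.pi)))
    obtain ⟨C', hC'⟩ := isCompact_Icc.exists_bound_of_continuousOn
      (cy'.continuousOn (s := Icc 0 (2 * Real.pi)))
    set B := 2 / k0 + 2 * M / k0 * ρ
    refine MemLp.of_bound (C := B * C' + |lam| * B * C) ?_ ?_
    · refine (Complex.measurable_ofReal.comp ?_).aestronglyMeasurable
      exact (hsb.measp.neg.mul cy'.measurable).sub ((hsb.measw.const_mul lam).mul cy.measurable)
    · rw [platoonMeasure, ae_restrict_iff' measurableSet_Icc]
      refine Eventually.of_forall fun x hx ↦ ?_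
      have hB : 0 ≤ B := (abs_nonneg _).trans (hsb.lep 0)
      rw [Complex.norm_real, Real.norm_eq_abs]
      refine (abs_sub _ _).trans ?_
      rw [abs_mul, abs_mul, abs_mul, abs_neg]
      have := hsb.lep x
      have := hsb.lew x
      have := hC x hx
      have := hC' x hx
      rw [Real.norm_eq_abs] at *
      gcongr
  · filter_upwards [hm, hs] with x em es
    have q0 : (0 : ℝ) < leadCoeff k0 ε ks' x :=
      (by positivity : 0 < k0 / 2).trans_le (leadCoeff_bounds hε (h.les x)).1
    have q0' : ((leadCoeff k0 ε ks' x : ℝ) : ℂ) ≠ 0 := by exact_mod_cast q0.ne'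
    have ρ0 : (ρ : ℂ) ≠ 0 := by exact_mod_cast hρ.ne'
    have hq : ((leadCoeff k0 ε ks' x : ℝ) : ℂ) = k0 + ε * ks' x / 2 := by
      simp [leadCoeff]
    have key : (leadCoeff k0 ε ks' x : ℂ) *
        ((-(ε * ρ * km' x / leadCoeff k0 ε ks' x) * y' x -
          lam * (1 / leadCoeff k0 ε ks' x) * y x : ℝ) : ℂ) =
        -(ε * ρ * km' x * y' x) - lam * y x := by
      push_cast
      field_simp
    rw [hq, hlam] at key
    rw [em, es, waveSpeedSq, ← hρd]
    generalize ((-(ε * ρ * km' x / leadCoeff k0 ε ks' x) * y' x -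
      lam * (1 / leadCoeff k0 ε ks' x) * y x : ℝ) : ℂ) = z at key ⊢
    push_cast
    field_simp
    linear_combination (-2) * key

/-- A continuous function on an interval at which the cosine vanishes is constant. -/
theorem eqOn_of_cos_eq_zero {f : ℝ → ℝ} {a b : ℝ} (hf : ContinuousOn f (Icc a b))
    (h0 : ∀ x ∈ Icc a b, Real.cos (f x) = 0) : ∀ x ∈ Icc a b, f x = f a := by
  intro x hx
  have hd : IsDiscrete (range ((↑) : ℤ → ℝ)) := by
    rw [← image_univ]
    exact IsDiscrete.univ.image Int.isClosedEmbedding_coe_real.isInducing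
  have hmaps : MapsTo (fun x ↦ f x / Real.pi - 1 / 2) (Icc a b) (range ((↑) : ℤ → ℝ)) := by
    intro x hx
    obtain ⟨k, hk⟩ := Real.cos_eq_zero_iff.1 (h0 x hx)
    refine ⟨k, ?_⟩
    have := Real.pi_ne_zero
    simp only [hk]
    field_simp
    ring
  have := isPreconnected_Icc.constant_of_mapsTo hd
    ((hf.div_const _).sub continuousOn_const) hmaps hx (⟨le_rfl, hx.1.trans hx.2⟩ : a ∈ Icc a b)
  have hpi := Real.pi_pos
  simp only [Pi.sub_apply] at this
  have h2 : f x / Real.pi = f a / Real.pi := by linarith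
  exact (div_left_inj' hpi.ne').1 h2

/-- A branch of eigenvalues is determined by the spectral parameter and its initial value. -/
theorem MistuningBdd.branch_unique (h : MistuningBdd k0 M km' ks')
    (hm : km =ᵐ[platoonMeasure] km') (hs : ks =ᵐ[platoonMeasure] ks') {ε₁ : ℝ} (hε₁ : 0 ≤ ε₁)
    (hε : ∀ ε ∈ Icc 0 ε₁, SmallMistuning k0 M ε) (hρ : 0 < meanDensity N) (hν : 0 < ν)
    {L : ℝ → ℝ} (hL : ∀ ε ∈ Icc 0 ε₁,
      platoonAngle k0 M ν (meanDensity N) km' ks' ε (L ε) (2 * Real.pi) = 2 * Real.pi * ν)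
    {s t : ℝ → ℂ} {s₀ : ℂ} (hb : IsEigenvalueBranchND b0 k0 km ks N ε₁ s₀ s)
    (ht : ContinuousOn t (Icc 0 ε₁)) (ht0 : t 0 = s₀)
    (htL : ∀ ε ∈ Icc 0 ε₁, (L ε : ℂ) = -(meanDensity N : ℂ) ^ 2 * (t ε ^ 2 + b0 * t ε))
    (htne : ∀ ε ∈ Icc 0 ε₁, t ε + b0 / 2 ≠ 0) : EqOn s t (Icc 0 ε₁) := by
  have ρ0 : (meanDensity N : ℂ) ≠ 0 := by exact_mod_cast hρ.ne'
  have h00 : (0 : ℝ) ∈ Icc 0 ε₁ := ⟨le_rfl, hε₁⟩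
  set f : ℝ → ℝ := fun ε ↦ (-(meanDensity N : ℂ) ^ 2 * (s ε ^ 2 + b0 * s ε)).re with hf
  have hlam : ∀ ε ∈ Icc 0 ε₁, (f ε : ℂ) = -(meanDensity N : ℂ) ^ 2 * (s ε ^ 2 + b0 * s ε) ∧
      Real.cos (platoonAngle k0 M ν (meanDensity N) km' ks' ε (f ε) (2 * Real.pi)) = 0 := by
    intro e he
    obtain ⟨lam, h1, h2⟩ := h.exists_lam_of_eigenvalue hm hs (hε e he) hρ hν
      (hb.isEigenvalue e he)
    have : f e = lam := by simp only [hf, ← h1, Complex.ofReal_re]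
    rw [this]
    exact ⟨h1, h2⟩
  have fc : ContinuousOn f (Icc 0 ε₁) :=
    Complex.continuous_re.comp_continuousOn
      (((hb.continuousOn.pow 2).add (hb.continuousOn.const_smul (b0 : ℂ))).const_smul
        (-(meanDensity N : ℂ) ^ 2))
  have Θc : ContinuousOn
      (fun e ↦ platoonAngle k0 M ν (meanDensity N) km' ks' e (f e) (2 * Real.pi)) (Icc 0 ε₁) :=
    fun e he ↦ h.angle_tendsto (hε e he) hρ.le hν (eventually_mem_nhdsWithin.mono hε)
      (tendsto_id.mono_left nhdsWithin_le_nhds) (fc e he)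
  -- The angle along the branch cannot leave its initial value `2πν`, so strict monotonicity
  -- identifies the spectral parameter with `L`.
  have hconst := eqOn_of_cos_eq_zero Θc fun e he ↦ (hlam e he).2
  have f0 : f 0 = L 0 := by
    have e1 := (hlam 0 h00).1
    rw [hb.start, ← ht0, ← htL 0 h00] at e1
    exact_mod_cast e1
  have fL : ∀ e ∈ Icc 0 ε₁, f e = L e := fun e he ↦ by
    refine (h.angle_strictMono (hε e he) hρ.le hν).injective ?_
    have := hconst e he
    simp only [f0, hL 0 h00] at this
    simp only [this, hL e he]
  have hsq : EqOn ((fun e ↦ s e + b0 / 2) ^ 2) ((fun e ↦ t e + (b0 : ℂ) / 2) ^ 2) (Icc 0 ε₁) := by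
    intro e he
    have e1 := (hlam e he).1
    rw [fL e he, htL e he] at e1
    have e2 := mul_left_cancel₀ (neg_ne_zero.2 (pow_ne_zero 2 ρ0)) e1
    simp only [Pi.pow_apply]
    linear_combination -e2
  -- After completing the square, `s` and `t` agree up to a sign about `-b₀/2`; as `t` never meets
  -- this double root, connectedness fixes the sign by its value at `0`.
  have key := isPreconnected_Icc.eq_of_sq_eq (hb.continuousOn.add continuousOn_const)
    (ht.add continuousOn_const) hsq (fun {e} he ↦ htne e he) h00
    (by simp [hb.start, ht0])
  intro e he
  simpa using key he

/-- First-order expansion of the less stable root of `s² + b₀ s + μ = 0`. -/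
theorem abs_root_expansion {μ μ₀ x e : ℝ} (hb0 : 0 < b0) (hμ : 0 ≤ μ) (hμ₀ : 0 ≤ μ₀)
    (h1 : 16 * μ ≤ 3 * b0 ^ 2) (h2 : 16 * μ₀ ≤ 3 * b0 ^ 2) (h : |μ - μ₀ - b0 * x| ≤ e) :
    |(√(b0 ^ 2 - 4 * μ) - √(b0 ^ 2 - 4 * μ₀)) / 2 + x| ≤
      e / b0 + |μ - μ₀| * (4 * (μ + μ₀) / b0 ^ 3) := by
  have root : ∀ m : ℝ, 0 ≤ m → 16 * m ≤ 3 * b0 ^ 2 → √(b0 ^ 2 - 4 * m) ^ 2 = b0 ^ 2 - 4 * m ∧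
      b0 / 2 ≤ √(b0 ^ 2 - 4 * m) ∧ √(b0 ^ 2 - 4 * m) ≤ b0 := fun m hm hm' ↦
    ⟨Real.sq_sqrt (by nlinarith), Real.le_sqrt_of_sq_le (by nlinarith),
      Real.sqrt_le_iff.2 ⟨hb0.le, by linarith⟩⟩
  obtain ⟨r1, r2, r3⟩ := root μ hμ h1
  obtain ⟨s1, s2, s3⟩ := root μ₀ hμ₀ h2
  set S := √(b0 ^ 2 - 4 * μ)
  set S₀ := √(b0 ^ 2 - 4 * μ₀)
  have hSS : b0 ≤ S + S₀ := by linarith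
  have hSS0 : 0 < S + S₀ := by linarith
  -- Since `S² - S₀² = -4(μ - μ₀)`, half the difference is `-2(μ - μ₀)/(S + S₀)`; replacing `S + S₀`
  -- by `2 b₀` produces the first term on the right.
  have e1 : (S - S₀) / 2 + x =
      -((μ - μ₀) * ((2 * b0 - S - S₀) / (b0 * (S + S₀)))) - (μ - μ₀ - b0 * x) / b0 := by
    field_simp
    linear_combination b0 * (r1 - s1)
  have gap : ∀ m σ : ℝ, σ ^ 2 = b0 ^ 2 - 4 * m → 0 ≤ σ → σ ≤ b0 → b0 - σ ≤ 4 * m / b0 := by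
    intro m σ hσ h0 hle
    rw [le_div_iff₀ hb0]
    nlinarith
  have g1 := gap μ S r1 (by linarith) r3
  have g2 := gap μ₀ S₀ s1 (by linarith) s3
  have e2 : |(2 * b0 - S - S₀) / (b0 * (S + S₀))| ≤ 4 * (μ + μ₀) / b0 ^ 3 := by
    rw [abs_of_nonneg (by apply div_nonneg <;> nlinarith)]
    calc _ ≤ (4 * (μ + μ₀) / b0) / (b0 * b0) := by
          gcongr
          rw [mul_add, add_div]
          linarith
      _ = _ := by field_simp
  rw [e1]
  refine (abs_sub _ _).trans ?_
  rw [abs_neg, abs_mul, abs_div _ b0, abs_of_pos hb0, add_comm]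
  gcongr

end Branches

/-! ### Uniform estimate of the roots and the main theorem. -/

theorem quadratic_root {b0 ρ L S σ : ℝ} (hρ : 0 < ρ) (hS : S ^ 2 = b0 ^ 2 - 4 * (L / ρ ^ 2))
    (hS0 : 0 < S) (hσ : σ ^ 2 = 1) :
    (L : ℂ) = -(ρ : ℂ) ^ 2 * ((((-b0 + σ * S) / 2 : ℝ) : ℂ) ^ 2 +
      b0 * (((-b0 + σ * S) / 2 : ℝ) : ℂ)) ∧ (((-b0 + σ * S) / 2 : ℝ) : ℂ) + b0 / 2 ≠ 0 := by
  constructor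
  · have e1 : L = -ρ ^ 2 * (((-b0 + σ * S) / 2) ^ 2 + b0 * ((-b0 + σ * S) / 2)) := by
      have e2 : ((-b0 + σ * S) / 2) ^ 2 + b0 * ((-b0 + σ * S) / 2) = -(L / ρ ^ 2) := by
        linear_combination (1 / 4) * hS + (S ^ 2 / 4) * hσ
      rw [e2]
      field_simp
    exact_mod_cast e1
  · have e1 : (((-b0 + σ * S) / 2 : ℝ) : ℂ) + b0 / 2 = ((σ * S / 2 : ℝ) : ℂ) := by
      push_cast; ring
    have hσ0 : σ ≠ 0 := by rintro rfl; norm_num at hσ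
    rw [e1]
    exact_mod_cast div_ne_zero (mul_ne_zero hσ0 hS0.ne') two_ne_zero

/-- The quadratic error is the product of `|μ - μ₀| = O(ε)` and `μ + μ₀ = O(ε² + r)`, hence `O(ε² +
ε r)`. With `r = 1/ρ²` this gives the factor `ε` in front of the `1/N²` correction. -/
theorem abs_root_expansion_le {b0 C₁ C₅ c ε r μ μ₀ x : ℝ} (hb0 : 0 < b0) (hC₁ : 0 ≤ C₁)
    (hC₅ : 0 ≤ C₅) (hc : 0 ≤ c) (hε0 : 0 ≤ ε) (hε1 : ε ≤ 1) (hr1 : r ≤ 1)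
    (hμ : 0 ≤ μ) (hμ₀ : 0 ≤ μ₀) (h1 : 16 * μ ≤ 3 * b0 ^ 2) (h2 : 16 * μ₀ ≤ 3 * b0 ^ 2)
    (h3 : μ ≤ C₅ * (ε ^ 2 + r)) (h4 : μ₀ ≤ C₅ * (ε ^ 2 + r))
    (h5 : |μ - μ₀ - b0 * x| ≤ C₁ * (ε ^ 2 + ε * r)) (h6 : |b0 * x| ≤ c * ε) :
    |(√(b0 ^ 2 - 4 * μ) - √(b0 ^ 2 - 4 * μ₀)) / 2 + x| ≤
      (C₁ / b0 + (2 * C₁ + c) * (8 * C₅ / b0 ^ 3)) * (ε ^ 2 + ε * r) := by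
  have e1 := abs_root_expansion hb0 hμ hμ₀ h1 h2 h5
  have e2 : |μ - μ₀| ≤ (2 * C₁ + c) * ε := by
    rw [show μ - μ₀ = (μ - μ₀ - b0 * x) + b0 * x by ring]
    refine (abs_add_le _ _).trans ?_
    have e5 : ε ^ 2 + ε * r ≤ 2 * ε := by nlinarith
    have e6 := mul_le_mul_of_nonneg_left e5 hC₁
    linarith
  have e4 : |μ - μ₀| * (4 * (μ + μ₀) / b0 ^ 3) ≤
      (2 * C₁ + c) * (8 * C₅ / b0 ^ 3) * (ε ^ 2 + ε * r) := by
    have p0 : 0 ≤ μ + μ₀ := add_nonneg hμ hμ₀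
    have p2 : μ + μ₀ ≤ 2 * (C₅ * (ε ^ 2 + r)) := by linarith
    have p3 : 0 ≤ C₅ * (ε ^ 2 + r) := hμ.trans h3
    calc _ ≤ (2 * C₁ + c) * ε * (4 * (2 * (C₅ * (ε ^ 2 + r))) / b0 ^ 3) := by gcongr
      _ = (2 * C₁ + c) * (8 / b0 ^ 3) * (ε * (C₅ * (ε ^ 2 + r))) := by ring
      _ ≤ (2 * C₁ + c) * (8 / b0 ^ 3) * (C₅ * (ε ^ 2 + ε * r)) := by
        refine mul_le_mul_of_nonneg_left ?_ (by positivity)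
        have : ε * ε ^ 2 ≤ 1 * ε ^ 2 := by gcongr
        have := mul_le_mul_of_nonneg_left this hC₅
        linarith
      _ = _ := by ring
  refine e1.trans ?_
  rw [add_mul]
  have : C₁ * (ε ^ 2 + ε * r) / b0 = C₁ / b0 * (ε ^ 2 + ε * r) := by ring
  linarith

set_option maxHeartbeats 1000000 in
theorem mainTheorem4 (b0 k0 : ℝ) (hb0 : 0 < b0) (hk0 : 0 < k0) (km ks : ℝ → ℝ)
    (hkm : MemLp km ⊤ platoonMeasure) (hks : MemLp ks ⊤ platoonMeasure)
    (l : ℕ) (hl : 1 ≤ l) :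
    ∃ (ε₀ : ℝ) (N₀ : ℕ) (C : ℝ), 0 < ε₀ ∧ ∀ N : ℕ, N₀ ≤ N →
      0 < nominalDiscr b0 k0 N l ∧
      ∃ sp sm : ℝ → ℂ,
        -- the branches through the nominal pair exist and are unique
        IsEigenvalueBranchND b0 k0 km ks N ε₀ (nominalPlus b0 k0 N l) sp ∧
        IsEigenvalueBranchND b0 k0 km ks N ε₀ (nominalMinus b0 k0 N l) sm ∧
        (∀ ε₁ : ℝ, 0 < ε₁ → ε₁ ≤ ε₀ → ∀ s : ℝ → ℂ,
          (IsEigenvalueBranchND b0 k0 km ks N ε₁ (nominalPlus b0 k0 N l) s →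
            EqOn s sp (Icc 0 ε₁)) ∧
          (IsEigenvalueBranchND b0 k0 km ks N ε₁ (nominalMinus b0 k0 N l) s →
            EqOn s sm (Icc 0 ε₁))) ∧
        -- the asymptotic formulas, uniformly in `ε` and `N`
        (∀ ε ∈ Icc 0 ε₀,
          ‖sp ε - (-ε * mistuningCoeff b0 km N l : ℝ)‖ ≤ C * ε ^ 2 + C / (N : ℝ) ^ 2 ∧
          ‖sm ε - (-b0 + ε * mistuningCoeff b0 km N l : ℝ)‖ ≤ C * ε ^ 2 + C / (N : ℝ) ^ 2) ∧
        -- in them, the `O(1/N²)` term is the nominal part plus `ε` times an `O(1/N²)` correction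
        -- of the first-order coefficient
        ‖sp 0‖ ≤ C / (N : ℝ) ^ 2 ∧ ‖sm 0 + b0‖ ≤ C / (N : ℝ) ^ 2 ∧
        (∀ ε ∈ Icc 0 ε₀,
          ‖sp ε - sp 0 - (-ε * mistuningCoeff b0 km N l : ℝ)‖ ≤
            C * ε ^ 2 + ε * (C / (N : ℝ) ^ 2) ∧
          ‖sm ε - sm 0 - (ε * mistuningCoeff b0 km N l : ℝ)‖ ≤
            C * ε ^ 2 + ε * (C / (N : ℝ) ^ 2)) := by
  have hT : (0 : ℝ) < 2 * Real.pi := Real.two_pi_pos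
  have hπ := Real.pi_pos
  -- bounded representatives of the profiles
  obtain ⟨M₁, hM₁⟩ := exists_bdd_representative hkm
  obtain ⟨M₂, hM₂⟩ := exists_bdd_representative hks
  set M := max 1 (max M₁ M₂) with hMdef
  have hM : 0 < M := zero_lt_one.trans_le (le_max_left _ _)
  obtain ⟨km', m1, m2, hm⟩ := hM₁ M ((le_max_left _ _).trans (le_max_right _ _))
  obtain ⟨ks', s1, s2, hs⟩ := hM₂ M ((le_max_right _ _).trans (le_max_right _ _))
  have h : MistuningBdd k0 M km' ks' := ⟨hk0, hM, m1, s1, m2, s2⟩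
  set ν : ℝ := (2 * (l : ℝ) - 1) / 4 with hνdef
  have hl' : (1 : ℝ) ≤ l := by exact_mod_cast hl
  have hν : 0 < ν := by rw [hνdef]; linarith
  have hcos : Real.cos (2 * Real.pi * ν) = 0 := by
    refine Real.cos_eq_zero_iff.2 ⟨(l : ℤ) - 1, ?_⟩
    rw [hνdef]; push_cast; ring
  have h4 : Real.sin (4 * Real.pi * ν) = 0 := by
    rw [show 4 * Real.pi * ν = 2 * (2 * Real.pi * ν) by ring, Real.sin_two_mul, hcos, mul_zero]
  obtain ⟨C₁, R, hC₁, hR, hexp⟩ := h.exists_lam_expansion hν h4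
  set I := ∫ t in (0 : ℝ)..(2 * Real.pi), km' t * Real.sin (2 * ν * t) with hI
  have hIeq : ∫ x in (0 : ℝ)..(2 * Real.pi), km x * Real.sin ((2 * (l : ℝ) - 1) * x / 2) = I := by
    refine intervalIntegral.integral_congr_ae ?_
    rw [Filter.EventuallyEq, platoonMeasure, ae_restrict_iff' measurableSet_Icc] at hm
    filter_upwards [hm] with x hx hx'
    rw [uIoc_of_le hT.le] at hx'
    rw [hx (Ioc_subset_Icc_self hx'), hνdef]
    congr 2; ring
  set c := ν / (2 * Real.pi) * I with hc
  set K := M / k0 with hK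
  have hK0 : 0 < K := by positivity
  -- the constants
  set τ := min 1 (b0 ^ 2 / (8 * k0)) with hτ
  have hτ0 : 0 < τ := by positivity
  have hτb : 16 * (3 * k0 / 2 * τ ^ 2) ≤ 3 * b0 ^ 2 := by
    have t1 : τ ^ 2 ≤ b0 ^ 2 / (8 * k0) := by
      rw [sq]
      calc τ * τ ≤ 1 * (b0 ^ 2 / (8 * k0)) := by
            gcongr
            exacts [min_le_left _ _, min_le_right _ _]
        _ = _ := one_mul _
    calc 16 * (3 * k0 / 2 * τ ^ 2) ≤ 16 * (3 * k0 / 2 * (b0 ^ 2 / (8 * k0))) := by gcongr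
      _ = 3 * b0 ^ 2 := by field_simp; ring
  set ε₀ := min 1 (min (1 / K) (τ / (2 * K))) with hε₀
  have hε₀0 : 0 < ε₀ := by positivity
  have hsmall : ∀ ε ∈ Icc 0 ε₀, SmallMistuning k0 M ε := fun ε hε ↦ by
    refine ⟨hε.1, hε.2.trans (min_le_left _ _), ?_⟩
    have : ε ≤ 1 / K := hε.2.trans ((min_le_right _ _).trans (min_le_left _ _))
    rw [hK, one_div_div, le_div_iff₀ hM] at this
    exact this
  set R' := max R (2 * ν / τ) with hR'
  set C₅ := 3 * k0 * (ν ^ 2 + K ^ 2) with hC₅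
  set C₇ := C₁ / b0 + (2 * C₁ + |c|) * (8 * C₅ / b0 ^ 3) with hC₇
  have hC₅0 : 0 ≤ C₅ := by positivity
  have hC₇0 : 0 ≤ C₇ := by positivity
  set C₈ := 2 * k0 * ν ^ 2 / b0 with hC₈
  have hC₈0 : 0 ≤ C₈ := by positivity
  -- The factor `(2π)²` converts `1/ρ²` into `1/N²`; `C₇` bounds the mistuning error and `C₈` the
  -- nominal value.
  set C := (C₇ + C₈) * (2 * Real.pi) ^ 2 with hC
  have h2π : 1 ≤ (2 * Real.pi) ^ 2 := one_le_pow₀ (by linarith [Real.pi_gt_three])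
  refine ⟨ε₀, ⌈2 * Real.pi * R'⌉₊, C, hε₀0, fun N hN ↦ ?_⟩
  have hNR : 2 * Real.pi * R' ≤ N := Nat.ceil_le.1 hN
  have hρR' : R' ≤ meanDensity N := by
    rw [meanDensity, le_div_iff₀ hT]; linarith
  set ρ := meanDensity N with hρdef
  have hρR : R ≤ ρ := (le_max_left _ _).trans hρR'
  have hρ1 : 1 ≤ ρ := hR.trans hρR
  have hρ : 0 < ρ := zero_lt_one.trans_le hρ1
  have hNρ : (N : ℝ) = 2 * Real.pi * ρ := by rw [hρdef, meanDensity]; field_simp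
  have hρν : ν / ρ ≤ τ / 2 := by
    have := (le_max_right _ _).trans hρR'
    rw [div_le_iff₀ hτ0] at this
    rw [div_le_iff₀ hρ]; linarith
  -- the spectral parameter
  have hex : ∀ ε ∈ Icc 0 ε₀, ∃ lam, 0 < lam ∧ lam ≤ 3 * k0 / 2 * pruferScale k0 M ν ρ ε ^ 2 ∧
      platoonAngle k0 M ν ρ km' ks' ε lam (2 * Real.pi) = 2 * Real.pi * ν :=
    fun ε hε ↦ h.exists_lam (hsmall ε hε) hρ.le hν
  choose! L hL0 hL1 hL using hex
  have hLc : ContinuousOn L (Icc 0 ε₀) := h.continuousOn_lam hsmall hρ.le hν hL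
  have h00 : (0 : ℝ) ∈ Icc 0 ε₀ := ⟨le_rfl, hε₀0.le⟩
  have hLnom : L 0 = k0 * ν ^ 2 :=
    (h.angle_strictMono (hsmall 0 h00) hρ.le hν).injective
      ((hL 0 h00).trans (h.angle_nominal hρ.le hν).symm)
  let μ : ℝ → ℝ := fun ε ↦ L ε / ρ ^ 2
  have hμ0 : ∀ ε ∈ Icc 0 ε₀, 0 ≤ μ ε := fun ε hε ↦ div_nonneg (hL0 ε hε).le (sq_nonneg _)
  have hμ1 : ∀ ε ∈ Icc 0 ε₀, μ ε ≤ 3 * k0 / 2 * (ν / ρ + K * ε) ^ 2 := fun ε hε ↦ by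
    have := hL1 ε hε
    simp only [μ]
    rw [div_le_iff₀ (by positivity)]
    refine this.trans_eq ?_
    rw [pruferScale, ← hK]
    field_simp
  have hμ2 : ∀ ε ∈ Icc 0 ε₀, 16 * μ ε ≤ 3 * b0 ^ 2 := fun ε hε ↦ by
    have e1 : K * ε ≤ τ / 2 := by
      have : ε ≤ τ / (2 * K) := hε.2.trans ((min_le_right _ _).trans (min_le_right _ _))
      rw [le_div_iff₀ (by positivity)] at this
      linarith
    have e2 : ν / ρ + K * ε ≤ τ := by linarith
    have e3 : 0 ≤ ν / ρ + K * ε := by have := hε.1; positivity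
    have e4 : 3 * k0 / 2 * (ν / ρ + K * ε) ^ 2 ≤ 3 * k0 / 2 * τ ^ 2 := by gcongr
    linarith [hμ1 ε hε]
  have hμ3 : ∀ ε ∈ Icc 0 ε₀, μ ε ≤ C₅ * (ε ^ 2 + 1 / ρ ^ 2) := fun ε hε ↦ by
    refine (hμ1 ε hε).trans ?_
    have e1 : (ν / ρ + K * ε) ^ 2 ≤ 2 * (ν ^ 2 * (1 / ρ ^ 2) + K ^ 2 * ε ^ 2) :=
      add_sq_le.trans_eq (by ring)
    have e2 : 0 ≤ ν ^ 2 * ε ^ 2 + K ^ 2 * (1 / ρ ^ 2) := by positivity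
    calc _ ≤ 3 * k0 / 2 * (2 * (ν ^ 2 * (1 / ρ ^ 2) + K ^ 2 * ε ^ 2)) := by gcongr
      _ ≤ 3 * k0 / 2 * (2 * (ν ^ 2 * (1 / ρ ^ 2) + K ^ 2 * ε ^ 2 +
          (ν ^ 2 * ε ^ 2 + K ^ 2 * (1 / ρ ^ 2)))) := by
          refine mul_le_mul_of_nonneg_left ?_ (by positivity)
          linarith
      _ = _ := by rw [hC₅]; ring
  have hμnom : μ 0 = k0 * ν ^ 2 / ρ ^ 2 := by simp only [μ, hLnom]
  have hdisc : nominalDiscr b0 k0 N l = b0 ^ 2 - 4 * μ 0 := by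
    rw [hμnom, nominalDiscr, waveSpeedSq, ← hρdef, hνdef]; ring
  -- the roots
  let S : ℝ → ℝ := fun ε ↦ √(b0 ^ 2 - 4 * μ ε)
  have hSsq : ∀ ε ∈ Icc 0 ε₀, S ε ^ 2 = b0 ^ 2 - 4 * μ ε := fun ε hε ↦
    Real.sq_sqrt (by linarith [hμ2 ε hε, sq_nonneg b0])
  have hSpos : ∀ ε ∈ Icc 0 ε₀, 0 < S ε := fun ε hε ↦
    Real.sqrt_pos.2 (by linarith [hμ2 ε hε, pow_pos hb0 2])
  have hSc : ContinuousOn S (Icc 0 ε₀) :=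
    (continuousOn_const.sub (continuousOn_const.mul (hLc.div_const _))).sqrt
  have hA : ∀ ε, ε * mistuningCoeff b0 km N l = ε * c / (ρ * b0) := fun ε ↦ by
    rw [mistuningCoeff, hIeq, hNρ, hc, hνdef]
    field_simp
  have branch : ∀ σ : ℝ, σ ^ 2 = 1 → ContinuousOn (fun ε ↦ (((-b0 + σ * S ε) / 2 : ℝ) : ℂ))
      (Icc 0 ε₀) ∧ ∀ ε ∈ Icc 0 ε₀,
        (L ε : ℂ) = -(ρ : ℂ) ^ 2 * ((((-b0 + σ * S ε) / 2 : ℝ) : ℂ) ^ 2 +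
          b0 * (((-b0 + σ * S ε) / 2 : ℝ) : ℂ)) ∧ (((-b0 + σ * S ε) / 2 : ℝ) : ℂ) + b0 / 2 ≠ 0 := by
    intro σ hσ
    refine ⟨Complex.continuous_ofReal.comp_continuousOn
      ((continuousOn_const.add (continuousOn_const.mul hSc)).div_const 2), fun ε hε ↦
        quadratic_root hρ (hSsq ε hε) (hSpos ε hε) hσ⟩
  have isBranch : ∀ (σ : ℝ) (s₀ : ℂ), σ ^ 2 = 1 → (((-b0 + σ * S 0) / 2 : ℝ) : ℂ) = s₀ →
      IsEigenvalueBranchND b0 k0 km ks N ε₀ s₀ (fun ε ↦ (((-b0 + σ * S ε) / 2 : ℝ) : ℂ)) :=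
    fun σ s₀ hσ h0 ↦ ⟨(branch σ hσ).1, h0, fun ε hε ↦
      h.isEigenvalueND hm hs (hsmall ε hε) hρ hν ((branch σ hσ).2 ε hε).1
        (by rw [← hρdef, hL ε hε, hcos])⟩
  have unique : ∀ (σ : ℝ) (s₀ : ℂ), σ ^ 2 = 1 → (((-b0 + σ * S 0) / 2 : ℝ) : ℂ) = s₀ →
      ∀ ε₁, 0 < ε₁ → ε₁ ≤ ε₀ → ∀ s : ℝ → ℂ, IsEigenvalueBranchND b0 k0 km ks N ε₁ s₀ s →
        EqOn s (fun ε ↦ (((-b0 + σ * S ε) / 2 : ℝ) : ℂ)) (Icc 0 ε₁) := by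
    intro σ s₀ hσ h0 ε₁ hε₁ hle s hbr
    have hsub : Icc 0 ε₁ ⊆ Icc 0 ε₀ := Icc_subset_Icc_right hle
    exact h.branch_unique hm hs hε₁.le (fun ε hε ↦ hsmall ε (hsub hε)) hρ hν
      (fun ε hε ↦ hL ε (hsub hε)) hbr ((branch σ hσ).1.mono hsub) h0
      (fun ε hε ↦ ((branch σ hσ).2 ε (hsub hε)).1) (fun ε hε ↦ ((branch σ hσ).2 ε (hsub hε)).2)
  have startP : (((-b0 + 1 * S 0) / 2 : ℝ) : ℂ) = nominalPlus b0 k0 N l := by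
    rw [nominalPlus, hdisc, one_mul]
  have startM : (((-b0 + (-1) * S 0) / 2 : ℝ) : ℂ) = nominalMinus b0 k0 N l := by
    rw [nominalMinus, hdisc, neg_one_mul, ← sub_eq_add_neg]
  -- the asymptotics
  have asym : ∀ ε ∈ Icc 0 ε₀, |(S ε - S 0) / 2 + ε * mistuningCoeff b0 km N l| ≤
      C₇ * (ε ^ 2 + ε * (1 / ρ ^ 2)) := by
    intro ε hε
    have hε0 := hε.1
    have hε1 := (hsmall ε hε).2.1
    have hr : 1 / ρ ^ 2 ≤ 1 := by
      rw [div_le_one (by positivity)]; exact one_le_pow₀ hρ1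
    have hr0 : 0 < 1 / ρ ^ 2 := by positivity
    have e0 : |μ ε - μ 0 - b0 * (ε * mistuningCoeff b0 km N l)| ≤
        C₁ * (ε ^ 2 + ε * (1 / ρ ^ 2)) := by
      have e1 := hexp ε ρ (L ε) (hsmall ε hε) hρR (hL0 ε hε) (hL1 ε hε) (hL ε hε)
      have e2 : μ ε - μ 0 - b0 * (ε * mistuningCoeff b0 km N l) =
          (L ε - k0 * ν ^ 2 - ε * ρ * c) * (1 / ρ ^ 2) := by
        rw [hA, hμnom]
        simp only [μ]
        field_simp
      rw [e2, abs_mul, abs_of_pos hr0]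
      -- Division by `ρ²` makes the bound uniform in `N`: `(ε ρ)² + ε` becomes `ε² + ε/ρ²`.
      calc _ ≤ C₁ * ((ε * ρ) ^ 2 + ε) * (1 / ρ ^ 2) := by gcongr
        _ = _ := by field_simp
    have e1 : |b0 * (ε * mistuningCoeff b0 km N l)| ≤ |c| * ε := by
      have e2 : b0 * (ε * mistuningCoeff b0 km N l) = ε * c / ρ := by
        rw [hA]; field_simp
      rw [e2, abs_div, abs_mul, abs_of_nonneg hε0, abs_of_pos hρ, mul_comm]
      exact div_le_self (by positivity) hρ1
    have e2 : C₅ * (0 ^ 2 + 1 / ρ ^ 2) ≤ C₅ * (ε ^ 2 + 1 / ρ ^ 2) := by gcongr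
    exact abs_root_expansion_le hb0 hC₁ hC₅0 (abs_nonneg c) hε0 hε1 hr (hμ0 ε hε) (hμ0 0 h00)
      (hμ2 ε hε) (hμ2 0 h00) (hμ3 ε hε) ((hμ3 0 h00).trans e2) e0 e1
  have nom : |(-b0 + S 0) / 2| ≤ C₈ * (1 / ρ ^ 2) := by
    have e1 := hSsq 0 h00
    have e2 := hSpos 0 h00
    have e3 := hμ0 0 h00
    have e4 : S 0 ≤ b0 := abs_le_of_sq_le_sq' (by linarith) hb0.le |>.2
    rw [abs_of_nonpos (by linarith)]
    -- `b₀ (b₀ - S) ≤ (b₀ + S)(b₀ - S) = 4 μ`, and `μ 0` is of order `1/ρ²`.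
    have e5 : b0 * (b0 - S 0) ≤ 4 * μ 0 := by
      linarith [mul_nonneg e2.le (sub_nonneg.2 e4)]
    have e6 : C₈ * (1 / ρ ^ 2) = 2 * μ 0 / b0 := by rw [hμnom, hC₈]; field_simp
    rw [e6, le_div_iff₀ hb0]
    linarith
  have hCN : C / (N : ℝ) ^ 2 = (C₇ + C₈) * (1 / ρ ^ 2) := by
    rw [hC, hNρ]; field_simp
  have hCge : C₇ ≤ C := by
    rw [hC]
    calc C₇ ≤ (C₇ + C₈) * 1 := by linarith
      _ ≤ _ := by gcongr
  have nom' : |(-b0 + S 0) / 2| ≤ C / (N : ℝ) ^ 2 := by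
    rw [hCN]
    refine nom.trans ?_
    gcongr
    linarith
  have asym' : ∀ ε ∈ Icc 0 ε₀, |(S ε - S 0) / 2 + ε * mistuningCoeff b0 km N l| ≤
      C * ε ^ 2 + ε * (C / (N : ℝ) ^ 2) := by
    intro ε hε
    have hε0 := hε.1
    refine (asym ε hε).trans ?_
    rw [hCN]
    have t1 : C₇ * ε ^ 2 ≤ C * ε ^ 2 := by gcongr
    have t2 : 0 ≤ C₈ * (ε * (1 / ρ ^ 2)) := by positivity
    linarith
  have full : ∀ ε ∈ Icc 0 ε₀, |(-b0 + S ε) / 2 + ε * mistuningCoeff b0 km N l| ≤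
      C * ε ^ 2 + C / (N : ℝ) ^ 2 := by
    intro ε hε
    have hε0 := hε.1
    have hε1 := (hsmall ε hε).2.1
    have e1 : (-b0 + S ε) / 2 + ε * mistuningCoeff b0 km N l =
        ((S ε - S 0) / 2 + ε * mistuningCoeff b0 km N l) + (-b0 + S 0) / 2 := by ring
    rw [e1, hCN]
    refine (abs_add_le _ _).trans ?_
    have t0 := asym ε hε
    have t1 : C₇ * ε ^ 2 ≤ C * ε ^ 2 := by gcongr
    have t2 : C₇ * (ε * (1 / ρ ^ 2)) ≤ C₇ * (1 * (1 / ρ ^ 2)) := by gcongr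
    linarith [nom]
  refine ⟨?_, fun ε ↦ (((-b0 + 1 * S ε) / 2 : ℝ) : ℂ), fun ε ↦ (((-b0 + (-1) * S ε) / 2 : ℝ) : ℂ),
    isBranch 1 _ (by norm_num) startP, isBranch (-1) _ (by norm_num) startM,
    fun ε₁ hε₁ hle s ↦ ⟨unique 1 _ (by norm_num) startP ε₁ hε₁ hle s,
      unique (-1) _ (by norm_num) startM ε₁ hε₁ hle s⟩, fun ε hε ↦ ⟨?_, ?_⟩, ?_, ?_,
    fun ε hε ↦ ⟨?_, ?_⟩⟩
  · rw [hdisc]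
    linarith [hμ2 0 h00, pow_pos hb0 2]
  · rw [← Complex.ofReal_sub, Complex.norm_real, Real.norm_eq_abs]
    refine le_of_eq_of_le ?_ (full ε hε)
    congr 1; ring
  · rw [← Complex.ofReal_sub, Complex.norm_real, Real.norm_eq_abs, ← abs_neg]
    refine le_of_eq_of_le ?_ (full ε hε)
    congr 1; ring
  · rw [Complex.norm_real, Real.norm_eq_abs, one_mul]
    exact nom'
  · rw [← Complex.ofReal_add, Complex.norm_real, Real.norm_eq_abs, ← abs_neg]
    refine le_of_eq_of_le ?_ nom'
    congr 1; ring
  · rw [← Complex.ofReal_sub, ← Complex.ofReal_sub, Complex.norm_real, Real.norm_eq_abs]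
    refine le_of_eq_of_le ?_ (asym' ε hε)
    congr 1; ring
  · rw [← Complex.ofReal_sub, ← Complex.ofReal_sub, Complex.norm_real, Real.norm_eq_abs, ← abs_neg]
    refine le_of_eq_of_le ?_ (asym' ε hε)
    congr 1; ring
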